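/- **Setting.** Terms are built from variables $\mathcal X$, constants $\mathcal C$ and function symbols with fixed arities; $\mathcal N\subseteq\mathcal C$ is a set of nonces, and $\mathcal N$ and $\mathcal C\setminus\mathcal N$ are infinite. $\mathrm{Sub}(\cdot)$ and $\mathrm{Var}(\cdot)$ denote sets of subterms and of variables. A substitution $\sigma$ has domain $\mathrm{dom}(\sigma)=\{x : x\sigma\ne x\}$ and is ground if $x\sigma$ has no variables for $x\in\mathrm{dom}(\sigma)$; its size is its DAG size, the number of distinct terms in $\bigcup_{x\in\mathrm{dom}(\sigma)}(\{x\}\cup\mathrm{Sub}(x\sigma))$. A deduction system consists of a finite set of rules $l_1,\dots,l_n\to r$ with $\mathrm{Var}(r)\subseteq\bigcup_i\mathrm{Var}(l_i)$, the nonce creation rules $\to n$ for all $n\in\mathcal N$ (these two kinds are the standard rules), and the reception rules $!t$ for all terms $t$. It is a subterm deduction system if every standard rule other than a nonce creation is either a composition $x_1,\dots,x_n\to g(x_1,\dots,x_n)$ with distinct variables $x_i$, or satisfies $r\in\bigcup_i\mathrm{Sub}(l_i)$. A derivation $D$ is a finite sequence of ground instances of rules in which every left-hand side is contained in the set of right-hand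 sides of earlier steps. $\mathrm{RHS}_D(i)$ is the set of right-hand sides of the first $i$ steps, and $\mathrm{Next}_D(i)$ is the least $j>i$ such that step $j$ is a reception, or $|D|+1$ if there is none. $\mathrm{Der}(K)$ is the set of right-hand sides of last steps of derivations that receive only terms of $K$. A constraint system $\mathcal S$ is a finite sequence of constraints $?t$ (reception of $t$ by a service), $!t$ (emission of $t$ by a service) and $\natural t$ (non-deducibility of $t$) such that every variable of a constraint $!t$ occurs in an earlier constraint $?t'$, and every variable of a constraint $\natural t$ occurs in some constraint $?t'$. A ground substitution $\sigma$ with $\mathrm{dom}(\sigma)=\mathrm{Var}(\mathcal S)$ is a solution, $\sigma\models\mathcal S$, if for every $i$: $\mathcal S[i]={?t}$ implies $t\sigma\in\mathrm{Der}(K_i)$ and $\mathcal S[i]=\natural t$ implies $t\sigma\notin\mathrm{Der}(K_i)$, where $K_i=\{t_j\sigma : j\le i,\ \mathcal S[j]={!t_j}\}$. For a finite set $T$ of terms and a ground substitution $\sigma'$ with domain $\mathrm{Var}(T)$: a derivation $D$ is $(T,\sigma')$-maximal if for all $t\in\mathrm{Sub}(T)$ and $0\le i\le|D|$, $t\sigma'\in\mathrm{Der}(\mathrm{RHS}_D(i))$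 implies $t\sigma'\in\mathrm{RHS}_D(\mathrm{Next}_D(i)-1)$. $D$ is localized by $T$ for $\sigma'$ if, whenever step $i$ of $D$ is an instance of a standard rule with right-hand side $t\sigma'$ for a non-variable $t\in\mathrm{Sub}(T)$, there are $t_1,\dots,t_n\in\mathrm{Sub}(T)$ with $t_1\sigma',\dots,t_n\sigma'\in\mathrm{RHS}_D(i-1)$ such that $t_1,\dots,t_n\to t$ is an instance of a standard rule. The localization is one-to-one if moreover $t\mapsto t\sigma'$ is injective on $\mathrm{Sub}(T)$. **Theorem.** Let $\mathcal D$ be a subterm deduction system that contains a rule $x_1,x_2\to f(x_1,x_2)$ (with $x_1\neq x_2$), where $f$ is a binary function symbol that occurs in no other standard rule. Then there is a polynomial $p$, depending only on $\mathcal D$, with the following property. Let $\mathcal S$ be a constraint system, $\sigma\models\mathcal S$, $T\supseteq\mathrm{Sub}(\mathcal S)$ a finite set of terms, and $\sigma'$ a ground substitution of domain $\mathrm{Var}(T)$ that extends $\sigma$. Let $D$ be a $(T,\sigma')$-maximal derivation, one-to-one localized by $T$ for $\sigma'$, in which no term is deduced twice by a standard rule. Then there is a solution $\tau$ of $\mathcal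 S$ of size at most $p(|\mathrm{Sub}(T)|)$. -/

import Mathlib

universe u v w

namespace Deducibility

/-- Variables, function symbols with their arities, and constants; the nonces form a subset of the
constants, and both the nonces and the other constants are infinite. -/
structure Signature where
  Var : Type u
  Fn : Type v
  Const : Type w
  arity : Fn → ℕ
  nonces : Set Const
  nonces_infinite : nonces.Infinite
  nonces_compl_infinite : noncesᶜ.Infinite

/-- First-order terms over a signature. -/
inductive Term (Sg : Signature.{u, v, w}) : Type (max u v w)
  | var (x : Sg.Var) : Term Sg
  | const (c : Sg.Const) : Term Sg
  | app (g : Sg.Fn) (ts : Fin (Sg.arity g) → Term Sg) : Term Sg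

variable {Sg : Signature.{u, v, w}}

namespace Term

/-- The set of subterms of a term (the term itself included). -/
def subterms : Term Sg → Set (Term Sg)
  | var x => {var x}
  | const c => {const c}
  | app g ts => insert (app g ts) (⋃ i, (ts i).subterms)

/-- The variables of a term. -/
def vars (t : Term Sg) : Set Sg.Var := {x | var x ∈ t.subterms}

/-- A term is ground if it has no variables. -/
def IsGround (t : Term Sg) : Prop := t.vars = ∅

/-- The term is a variable. -/
def IsVar (t : Term Sg) : Prop := ∃ x, t = var x

/-- Application of a substitution: every variable `x` is replaced by `σ x`. -/
def subst (σ : Sg.Var → Term Sg) : Term Sg → Term Sg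
  | var x => σ x
  | const c => const c
  | app g ts => app g (fun i => (ts i).subst σ)

end Term

/-- Subterms of a set of terms. -/
def Sub (T : Set (Term Sg)) : Set (Term Sg) := ⋃ t ∈ T, t.subterms

/-- Variables of a set of terms. -/
def Vars (T : Set (Term Sg)) : Set Sg.Var := ⋃ t ∈ T, t.vars

/-- Substitutions. The ones the theory is about are ground on their domain, hence idempotent. -/
abbrev Subst (Sg : Signature.{u, v, w}) : Type (max u v w) := Sg.Var → Term Sg

namespace Subst

/-- The variables that are moved. -/
def dom (σ : Subst Sg) : Set Sg.Var := {x | σ x ≠ Term.var x}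

/-- Every variable of the domain is mapped to a ground term. -/
def IsGround (σ : Subst Sg) : Prop := ∀ x ∈ σ.dom, (σ x).IsGround

/-- DAG size: the number of distinct terms among the variables of the domain and
the subterms of their images. -/
noncomputable def size (σ : Subst Sg) : ℕ∞ :=
  (⋃ x ∈ σ.dom, insert (Term.var x) (σ x).subterms).encard

end Subst

/-- Deduction rules `l₁, …, lₙ → r` with `Var(r) ⊆ Var(l₁) ∪ … ∪ Var(lₙ)`. -/
structure Rule (Sg : Signature.{u, v, w}) where
  premises : Set (Term Sg)
  conclusion : Term Sg
  premises_finite : premises.Finite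
  vars_subset : conclusion.vars ⊆ Vars premises

/-- The nonce creation rule `→ n`. -/
def nonceRule (n : Sg.Const) : Rule Sg where
  premises := ∅
  conclusion := Term.const n
  premises_finite := Set.finite_empty
  vars_subset := by
    intro x hx
    simp [Term.vars, Term.subterms] at hx

/-- The rule `x₁, …, xₙ → g(x₁, …, xₙ)`. -/
def compositionRule (g : Sg.Fn) (x : Fin (Sg.arity g) → Sg.Var) : Rule Sg where
  premises := Set.range (fun i => Term.var (x i))
  conclusion := Term.app g (fun i => Term.var (x i))
  premises_finite := Set.finite_range _
  vars_subset := by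
    intro y hy
    simp only [Term.vars, Term.subterms, Set.mem_ofPred_eq, Set.mem_insert_iff, Set.mem_iUnion,
      Set.mem_singleton_iff, reduceCtorEq, false_or] at hy
    obtain ⟨i, hi⟩ := hy
    simp only [Vars, Set.mem_iUnion]
    exact ⟨_, ⟨i, rfl⟩, by
      have h : Term.var y ∈ (Term.var (x i)).subterms := by
        rw [Term.subterms, hi]
        exact Set.mem_singleton _
      exact h⟩

namespace Rule

/-- `x₁, …, xₙ → g(x₁, …, xₙ)` with pairwise distinct variables. -/
def IsComposition (R : Rule Sg) : Prop :=
  ∃ (g : Sg.Fn) (x : Fin (Sg.arity g) → Sg.Var), Function.Injective x ∧ R = compositionRule g x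

/-- The conclusion is a subterm of a premise. -/
def IsDecomposition (R : Rule Sg) : Prop := R.conclusion ∈ Sub R.premises

/-- The function symbol `g` occurs in the rule. -/
def Uses (R : Rule Sg) (g : Sg.Fn) : Prop :=
  ∃ ts, Term.app g ts ∈ Sub (insert R.conclusion R.premises)

/-- `l → r` is an instance (not necessarily ground) of the rule. -/
def IsInstance (R : Rule Sg) (l : Set (Term Sg)) (r : Term Sg) : Prop :=
  ∃ ρ : Subst Sg, l = Term.subst ρ '' R.premises ∧ r = R.conclusion.subst ρ

end Rule

/-- A deduction system is given by its finite set of rules besides the nonce creation rules and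
the reception rules, which belong to every deduction system. -/
structure DeductionSystem (Sg : Signature.{u, v, w}) where
  rules : Set (Rule Sg)
  rules_finite : rules.Finite

/-- A ground rule application: the reception of a message, or `l → r` for a standard rule. -/
inductive Deduction (Sg : Signature.{u, v, w}) : Type (max u v w)
  | reception (t : Term Sg) : Deduction Sg
  | standard (l : Set (Term Sg)) (r : Term Sg) : Deduction Sg

namespace Deduction

/-- Left-hand side of a deduction. -/
def lhs : Deduction Sg → Set (Term Sg)
  | reception _ => ∅
  | standard l _ => l

/-- Right-hand side of a deduction. -/
def rhs : Deduction Sg → Term Sg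
  | reception t => t
  | standard _ r => r

end Deduction

/-- The terms deduced by the first `i` steps. -/
def RHS (D : List (Deduction Sg)) (i : ℕ) : Set (Term Sg) := {r | ∃ d ∈ D.take i, d.rhs = r}

/-- With steps numbered from `1`: the first reception step after step `i`, or `|D| + 1` if there
is none. -/
noncomputable def next (D : List (Deduction Sg)) (i : ℕ) : ℕ :=
  sInf ({D.length + 1} ∪ {j : ℕ | i < j ∧ ∃ t, D[j - 1]? = some (Deduction.reception t)})

/-- No term is deduced twice by a standard rule. -/
def NoStandardRepetition (D : List (Deduction Sg)) : Prop :=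
  ∀ (i j : ℕ) (l l' : Set (Term Sg)) (r : Term Sg), D[i]? = some (Deduction.standard l r) →
    D[j]? = some (Deduction.standard l' r) → i = j

namespace DeductionSystem

variable (𝒟 : DeductionSystem Sg)

/-- All rules but the reception rules. -/
def standardRules : Set (Rule Sg) := 𝒟.rules ∪ {R | ∃ n ∈ Sg.nonces, R = nonceRule n}

/-- Subterm deduction systems. -/
def IsSubterm : Prop :=
  ∀ R ∈ 𝒟.standardRules,
    (∃ n ∈ Sg.nonces, R = nonceRule n) ∨ R.IsComposition ∨ R.IsDecomposition

/-- The system contains a rule `x₁, x₂ → f(x₁, x₂)` for a binary symbol `f` that occurs in no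
other standard rule. -/
def HasFreeBinaryComposition : Prop :=
  ∃ (f : Sg.Fn) (x : Fin (Sg.arity f) → Sg.Var), Sg.arity f = 2 ∧ Function.Injective x ∧
    compositionRule f x ∈ 𝒟.standardRules ∧
    ∀ R ∈ 𝒟.standardRules, R ≠ compositionRule f x → ¬ R.Uses f

/-- Ground instances of the rules of the system. -/
def IsDeduction : Deduction Sg → Prop
  | .reception t => t.IsGround
  | .standard l r => (∀ t ∈ l, t.IsGround) ∧ r.IsGround ∧ ∃ R ∈ 𝒟.standardRules, R.IsInstance l r

/-- Derivations: each left-hand side consists of terms deduced by earlier steps. -/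
def IsDerivation (D : List (Deduction Sg)) : Prop :=
  (∀ d ∈ D, 𝒟.IsDeduction d) ∧
    ∀ (i : ℕ) (d : Deduction Sg), D[i]? = some d → d.lhs ⊆ RHS D i

/-- The terms that can be deduced from the knowledge `K`: the last terms of the derivations that
receive only terms of `K`. -/
def Der (K : Set (Term Sg)) : Set (Term Sg) :=
  {t | ∃ D, 𝒟.IsDerivation D ∧ (∀ r, Deduction.reception r ∈ D → r ∈ K) ∧
    ∃ d, D.getLast? = some d ∧ d.rhs = t}

/-- `(T, σ)`-maximality of a derivation. -/
def IsMaximal (T : Set (Term Sg)) (σ : Subst Sg) (D : List (Deduction Sg)) : Prop :=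
  ∀ t ∈ Sub T, ∀ i ≤ D.length, t.subst σ ∈ 𝒟.Der (RHS D i) → t.subst σ ∈ RHS D (next D i - 1)

/-- `T` localizes `D` for `σ`. -/
def Localizes (T : Set (Term Sg)) (σ : Subst Sg) (D : List (Deduction Sg)) : Prop :=
  ∀ (i : ℕ) (l : Set (Term Sg)) (r : Term Sg), D[i]? = some (Deduction.standard l r) →
    ∀ t ∈ Sub T, ¬ t.IsVar → t.subst σ = r →
      ∃ ts ⊆ Sub T, Term.subst σ '' ts ⊆ RHS D i ∧ ∃ R ∈ 𝒟.standardRules, R.IsInstance ts t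

/-- `T` one-to-one localizes `D` for `σ`. -/
def OneToOneLocalizes (T : Set (Term Sg)) (σ : Subst Sg) (D : List (Deduction Sg)) : Prop :=
  Set.InjOn (Term.subst σ) (Sub T) ∧ 𝒟.Localizes T σ D

end DeductionSystem

/-- The three forms of constraints: `rcv t` (written `?t`): a service receives `t`, so the mediator
must be able to deduce it; `snd t` (written `!t`): a service sends `t` to the mediator;
`forbid t`: the mediator must not be able to deduce `t`. -/
inductive Constraint (Sg : Signature.{u, v, w}) : Type (max u v w)
  | rcv (t : Term Sg) : Constraint Sg
  | snd (t : Term Sg) : Constraint Sg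
  | forbid (t : Term Sg) : Constraint Sg

/-- The term of a constraint. -/
def Constraint.term : Constraint Sg → Term Sg
  | rcv t => t
  | snd t => t
  | forbid t => t

/-- Constraint systems. -/
structure ConstraintSystem (Sg : Signature.{u, v, w}) where
  constraints : List (Constraint Sg)
  origination : ∀ (i : ℕ) (t : Term Sg), constraints[i]? = some (Constraint.snd t) →
    t.vars ⊆ Vars {s : Term Sg | ∃ j : ℕ, j < i ∧ constraints[j]? = some (Constraint.rcv s)}
  determination : ∀ (i : ℕ) (t : Term Sg), constraints[i]? = some (Constraint.forbid t) →
    t.vars ⊆ Vars {s : Term Sg | ∃ j : ℕ, constraints[j]? = some (Constraint.rcv s)}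

namespace ConstraintSystem

variable (S : ConstraintSystem Sg)

/-- The terms of the constraints. -/
def terms : Set (Term Sg) := {t | ∃ c ∈ S.constraints, c.term = t}

/-- The `σ`-instances of the terms sent up to position `i`. -/
def knowledge (σ : Subst Sg) (i : ℕ) : Set (Term Sg) :=
  {u | ∃ j ≤ i, ∃ t, S.constraints[j]? = some (Constraint.snd t) ∧ u = t.subst σ}

/-- `σ` is a solution of the constraint system. -/
structure IsSolution (𝒟 : DeductionSystem Sg) (σ : Subst Sg) : Prop where
  ground : σ.IsGround
  dom_eq : σ.dom = Vars S.terms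
  rcv : ∀ (i : ℕ) (t : Term Sg), S.constraints[i]? = some (Constraint.rcv t) →
    t.subst σ ∈ 𝒟.Der (S.knowledge σ i)
  forbid : ∀ (i : ℕ) (t : Term Sg), S.constraints[i]? = some (Constraint.forbid t) →
    t.subst σ ∉ 𝒟.Der (S.knowledge σ i)

end ConstraintSystem

end Deducibility

/-!
The solution `σ` is made small by abstracting the terms whose inner structure is never used; the
resulting bound is linear in the number of subterms of the constraints.

Locality. Let `G` be the set of `σ`-instances of non-variable subterms of the constraints. A subterm
of a sent term lies in `G` or below the value of a variable, and that variable occurs in a term that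
was received, hence deducible, earlier (`IsSolution.originates`). In a subterm deduction system, a
decomposition yields a subterm of a premise. By induction on the position in the constraint system,
every subterm of a deducible term therefore lies in `G` or is itself deducible, and only
decompositions with conclusion in `G` are needed (`Originates.ded_restrict`). Following each term of
`G` back to its first deduction, at the least position and then with the least height, at most `|G|`
instances of decomposition rules suffice at all positions together (`exists_decompositions`).

Abstraction. Let `Z` be the set of those values of variables, of the constraints or of the chosen
decompositions, that are not also instances of non-variable subterms. Every `s ∈ Z` is deducible
from some position on. It is replaced by `f(n, c)`, where `n` is a nonce reserved for `s` and `c` is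
the chain `f(… f(f(n₀, u₁), u₂) …, uₘ)` of the abstracted terms sent up to that position. As `f` has
only its composition rule, `f(n, c)` is deducible exactly when `u₁, …, uₘ` are, which happens
exactly when `s` was deducible before. So the abstraction preserves deducibility
(`Abstraction.ded_abstract`, by induction on position and height, using that no chosen decomposition
looks inside a term of `Z`), and reflects it (`Abstraction.ded_of_ded_abstract`: putting the terms
of `Z` back turns deductions into deductions, since no rule but the composition of `f` can see where
the replacement took place). Positive and negative constraints thus stay satisfied
(`ConstraintSystem.IsSolution.exists_small`). The chains share their subterms, so the DAG size grows
by a constant factor only (`Abstraction.encard_support_le`).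
-/

namespace Deducibility

variable {Sg : Signature.{u, v, w}}

/-! ### Subterms, substitutions and replacements -/

namespace Term

theorem not_isVar_const (c : Sg.Const) : ¬ (const c : Term Sg).IsVar := by
  rintro ⟨x, hx⟩
  cases hx

theorem not_isVar_app (g : Sg.Fn) (ts : Fin (Sg.arity g) → Term Sg) : ¬ (app g ts).IsVar := by
  rintro ⟨x, hx⟩
  cases hx

theorem mem_subterms_self (t : Term Sg) : t ∈ t.subterms := by
  cases t <;> simp [subterms]

theorem mem_subterms_app {s : Term Sg} {g : Sg.Fn} {ts : Fin (Sg.arity g) → Term Sg} :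
    s ∈ (app g ts).subterms ↔ s = app g ts ∨ ∃ i, s ∈ (ts i).subterms := by
  simp [subterms]

theorem subterms_subset {s t : Term Sg} (h : s ∈ t.subterms) : s.subterms ⊆ t.subterms := by
  induction t with
  | var x => rw [subterms, Set.mem_singleton_iff] at h; rw [h]
  | const c => rw [subterms, Set.mem_singleton_iff] at h; rw [h]
  | app g ts ih =>
    rcases mem_subterms_app.1 h with rfl | ⟨i, hi⟩
    · exact subset_rfl
    · exact fun r hr => mem_subterms_app.2 (Or.inr ⟨i, ih i hi hr⟩)

theorem subterms_finite (t : Term Sg) : t.subterms.Finite := by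
  induction t with
  | var x => exact Set.finite_singleton _
  | const c => exact Set.finite_singleton _
  | app g ts ih => exact (Set.finite_iUnion ih).insert _

theorem arg_mem_subterms (g : Sg.Fn) (ts : Fin (Sg.arity g) → Term Sg) (i : Fin (Sg.arity g)) :
    ts i ∈ (app g ts).subterms :=
  mem_subterms_app.2 (Or.inr ⟨i, mem_subterms_self _⟩)

theorem subst_mem_subterms {s t : Term Sg} (h : s ∈ t.subterms) (ρ : Subst Sg) :
    s.subst ρ ∈ (t.subst ρ).subterms := by
  induction t with
  | var x => rw [subterms, Set.mem_singleton_iff] at h; rw [h]; exact mem_subterms_self _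
  | const c => rw [subterms, Set.mem_singleton_iff] at h; rw [h]; exact mem_subterms_self _
  | app g ts ih =>
    rcases mem_subterms_app.1 h with rfl | ⟨i, hi⟩
    · exact mem_subterms_self _
    · exact mem_subterms_app.2 (Or.inr ⟨i, ih i hi⟩)

/-- A subterm of an instance is an instance of a non-variable subterm or lies below a variable. -/
theorem mem_subterms_subst {s t : Term Sg} {ρ : Subst Sg} (h : s ∈ (t.subst ρ).subterms) :
    (∃ r ∈ t.subterms, ¬ r.IsVar ∧ s = r.subst ρ) ∨ ∃ x ∈ t.vars, s ∈ (ρ x).subterms := by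
  induction t with
  | var x => exact Or.inr ⟨x, mem_subterms_self _, h⟩
  | const c =>
    rw [subst, subterms, Set.mem_singleton_iff] at h
    exact Or.inl ⟨const c, mem_subterms_self _, not_isVar_const c, h⟩
  | app g ts ih =>
    rcases mem_subterms_app.1 h with h | ⟨i, hi⟩
    · exact Or.inl ⟨app g ts, mem_subterms_self _, not_isVar_app g ts, h⟩
    · rcases ih i hi with ⟨r, hr, hr'⟩ | ⟨x, hx, hx'⟩
      · exact Or.inl ⟨r, mem_subterms_app.2 (Or.inr ⟨i, hr⟩), hr'⟩
      · exact Or.inr ⟨x, mem_subterms_app.2 (Or.inr ⟨i, hx⟩), hx'⟩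

theorem isGround_iff {t : Term Sg} : t.IsGround ↔ ∀ x, var x ∉ t.subterms := by
  simp [IsGround, vars, Set.eq_empty_iff_forall_notMem]

theorem IsGround.of_mem_subterms {s t : Term Sg} (ht : t.IsGround) (h : s ∈ t.subterms) :
    s.IsGround :=
  isGround_iff.2 fun x hx => isGround_iff.1 ht x (subterms_subset h hx)

theorem isGround_const (c : Sg.Const) : (const c : Term Sg).IsGround :=
  isGround_iff.2 fun x hx => by simp [subterms] at hx

theorem isGround_app {g : Sg.Fn} {ts : Fin (Sg.arity g) → Term Sg} (h : ∀ i, (ts i).IsGround) :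
    (app g ts).IsGround :=
  isGround_iff.2 fun x hx => by
    rcases mem_subterms_app.1 hx with hx | ⟨i, hi⟩
    · cases hx
    · exact isGround_iff.1 (h i) x hi

theorem isGround_subst_iff {t : Term Sg} {ρ : Subst Sg} :
    (t.subst ρ).IsGround ↔ ∀ x ∈ t.vars, (ρ x).IsGround := by
  refine ⟨fun h x hx => h.of_mem_subterms (subst_mem_subterms (t := t) hx ρ), fun h => ?_⟩
  refine isGround_iff.2 fun y hy => ?_
  rcases mem_subterms_subst hy with ⟨r, hr, hv, he⟩ | ⟨x, hx, hx'⟩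
  · cases r with
    | var z => exact hv ⟨z, rfl⟩
    | const c => cases he
    | app g ts => cases he
  · exact isGround_iff.1 (h x hx) y hx'

theorem subst_congr {t : Term Sg} {ρ ρ' : Subst Sg} (h : ∀ x ∈ t.vars, ρ x = ρ' x) :
    t.subst ρ = t.subst ρ' := by
  induction t with
  | var x => exact h x (mem_subterms_self _)
  | const c => rfl
  | app g ts ih =>
    simp only [subst, app.injEq, heq_eq_eq, true_and]
    exact funext fun i => ih i fun x hx => h x (mem_subterms_app.2 (Or.inr ⟨i, hx⟩))

/-- Replace, from the root downwards, every subterm `s` with `φ s = some r` by `r`; the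
replacing terms are not searched again. -/
def replace (φ : Term Sg → Option (Term Sg)) : Term Sg → Term Sg
  | var x => (φ (var x)).getD (var x)
  | const c => (φ (const c)).getD (const c)
  | app g ts => (φ (app g ts)).getD (app g fun i => (ts i).replace φ)

theorem replace_of_some {φ : Term Sg → Option (Term Sg)} {t r : Term Sg} (h : φ t = some r) :
    t.replace φ = r := by
  cases t <;> simp [replace, h]

theorem replace_const_of_none {φ : Term Sg → Option (Term Sg)} {c : Sg.Const}
    (h : φ (const c) = none) : (const c).replace φ = const c := by
  simp [replace, h]

theorem replace_app_of_none {φ : Term Sg → Option (Term Sg)} {g : Sg.Fn}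
    {ts : Fin (Sg.arity g) → Term Sg} (h : φ (app g ts) = none) :
    (app g ts).replace φ = app g fun i => (ts i).replace φ := by
  simp [replace, h]

theorem replace_subst {φ : Term Sg → Option (Term Sg)} {t : Term Sg} {ρ : Subst Sg}
    (h : ∀ r ∈ t.subterms, ¬ r.IsVar → φ (r.subst ρ) = none) :
    (t.subst ρ).replace φ = t.subst fun x => (ρ x).replace φ := by
  induction t with
  | var x => rfl
  | const c => exact replace_const_of_none (h _ (mem_subterms_self _) (not_isVar_const c))
  | app g ts ih =>
    refine (replace_app_of_none (h _ (mem_subterms_self _) (not_isVar_app g ts))).trans ?_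
    simp only [subst, app.injEq, heq_eq_eq, true_and]
    exact funext fun i => ih i fun r hr => h r (mem_subterms_app.2 (Or.inr ⟨i, hr⟩))

theorem replace_congr {φ ψ : Term Sg → Option (Term Sg)} {t : Term Sg}
    (h : ∀ s ∈ t.subterms, φ s = ψ s) : t.replace φ = t.replace ψ := by
  induction t with
  | var x => simp only [replace, h _ (mem_subterms_self _)]
  | const c => simp only [replace, h _ (mem_subterms_self _)]
  | app g ts ih =>
    simp only [replace, h _ (mem_subterms_self _)]
    congr 2
    exact funext fun i => ih i fun s hs => h s (mem_subterms_app.2 (Or.inr ⟨i, hs⟩))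

theorem isGround_replace {φ : Term Sg → Option (Term Sg)} {t : Term Sg} (ht : t.IsGround)
    (h : ∀ s r, φ s = some r → r.IsGround) : (t.replace φ).IsGround := by
  induction t with
  | var x => exact absurd (mem_subterms_self _) (isGround_iff.1 ht x)
  | const c =>
    rcases hc : φ (const c) with _ | r
    · rw [replace_const_of_none hc]; exact isGround_const c
    · rw [replace_of_some hc]; exact h _ _ hc
  | app g ts ih =>
    rcases hc : φ (app g ts) with _ | r
    · rw [replace_app_of_none hc]
      exact isGround_app fun i => ih i (ht.of_mem_subterms (arg_mem_subterms g ts i))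
    · rw [replace_of_some hc]; exact h _ _ hc

end Term

theorem mem_Sub {T : Set (Term Sg)} {s : Term Sg} : s ∈ Sub T ↔ ∃ t ∈ T, s ∈ t.subterms := by
  simp [Sub]

theorem subset_Sub (T : Set (Term Sg)) : T ⊆ Sub T :=
  fun t ht => mem_Sub.2 ⟨t, ht, t.mem_subterms_self⟩

theorem mem_Sub_of_mem_subterms {T : Set (Term Sg)} {s t : Term Sg} (ht : t ∈ Sub T)
    (hs : s ∈ t.subterms) : s ∈ Sub T := by
  obtain ⟨r, hr, htr⟩ := mem_Sub.1 ht
  exact mem_Sub.2 ⟨r, hr, Term.subterms_subset htr hs⟩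

theorem Sub_finite {T : Set (Term Sg)} (hT : T.Finite) : (Sub T).Finite :=
  hT.biUnion fun t _ => t.subterms_finite

theorem mem_Vars {T : Set (Term Sg)} {x : Sg.Var} : x ∈ Vars T ↔ ∃ t ∈ T, x ∈ t.vars := by
  simp [Vars]

/-! ### Deducibility as an inductive closure -/

namespace DeductionSystem

variable (𝒟 : DeductionSystem Sg)

/-- The system has a composition rule for the symbol `g`. -/
def Composes (g : Sg.Fn) : Prop :=
  ∃ x : Fin (Sg.arity g) → Sg.Var, Function.Injective x ∧ compositionRule g x ∈ 𝒟.rules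

/-- The closure of `K` under nonce creations, compositions, and those instances of decomposition
rules whose conclusion lies in `G`. For a subterm deduction system, `G = Set.univ` and ground `K`,
this is `𝒟.Der K`. -/
inductive Ded (G K : Set (Term Sg)) : Term Sg → Prop
  | recv (t : Term Sg) : t ∈ K → Ded G K t
  | nonce (n : Sg.Const) : n ∈ Sg.nonces → Ded G K (.const n)
  | comp (g : Sg.Fn) (ts : Fin (Sg.arity g) → Term Sg) :
      𝒟.Composes g → (∀ i, Ded G K (ts i)) → Ded G K (.app g ts)
  | dec (R : Rule Sg) (ρ : Subst Sg) :
      R ∈ 𝒟.rules → R.IsDecomposition → R.conclusion.subst ρ ∈ G →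
      (∀ p ∈ R.premises, Ded G K (p.subst ρ)) → Ded G K (R.conclusion.subst ρ)

variable {𝒟}

theorem Ded.cut {G G' K K' : Set (Term Sg)} (hG : G ⊆ G') (hK : ∀ t ∈ K, 𝒟.Ded G' K' t)
    {t : Term Sg} (h : 𝒟.Ded G K t) : 𝒟.Ded G' K' t := by
  induction h with
  | recv t ht => exact hK t ht
  | nonce n hn => exact .nonce n hn
  | comp g ts hg _ ih => exact .comp g ts hg ih
  | dec R ρ hR hd hr _ ih => exact .dec R ρ hR hd (hG hr) ih

theorem Ded.mono {G K K' : Set (Term Sg)} (hK : K ⊆ K') {t : Term Sg} (h : 𝒟.Ded G K t) :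
    𝒟.Ded G K' t :=
  h.cut subset_rfl fun t ht => .recv t (hK ht)

theorem IsSubterm.ded_of_instance (hsub : 𝒟.IsSubterm) {K : Set (Term Sg)} {R : Rule Sg}
    (hR : R ∈ 𝒟.standardRules) {ρ : Subst Sg} (h : ∀ p ∈ R.premises, 𝒟.Ded Set.univ K (p.subst ρ)) :
    𝒟.Ded Set.univ K (R.conclusion.subst ρ) := by
  have nonce_case : (∃ n ∈ Sg.nonces, R = nonceRule n) →
      𝒟.Ded Set.univ K (R.conclusion.subst ρ) := by
    rintro ⟨n, hn, rfl⟩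
    exact .nonce n hn
  rcases hR with hR | hR
  · rcases hsub R (Or.inl hR) with hn | ⟨g, x, hx, rfl⟩ | hd
    · exact nonce_case hn
    · exact .comp g (fun i => ρ (x i)) ⟨x, hx, hR⟩ fun i => h _ ⟨i, rfl⟩
    · exact .dec R ρ hR hd trivial h
  · exact nonce_case hR

theorem Ded.of_mem_Der (hsub : 𝒟.IsSubterm) {K : Set (Term Sg)} {t : Term Sg} (h : t ∈ 𝒟.Der K) :
    𝒟.Ded Set.univ K t := by
  obtain ⟨D, ⟨hD, hl⟩, hK, d, hd, rfl⟩ := h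
  have key : ∀ (i : ℕ) (d : Deduction Sg), D[i]? = some d → 𝒟.Ded Set.univ K d.rhs := by
    intro i
    induction i using Nat.strong_induction_on with
    | _ i ih =>
      intro d hi
      have hmem : d ∈ D := List.mem_of_getElem? hi
      cases d with
      | reception t => exact .recv t (hK t hmem)
      | standard l r =>
        obtain ⟨-, -, R, hR, ρ, rfl, rfl⟩ := hD _ hmem
        refine hsub.ded_of_instance hR fun p hp => ?_
        obtain ⟨e, he, hep⟩ := hl i _ hi ⟨p, hp, rfl⟩
        obtain ⟨j, hj⟩ := List.mem_iff_getElem?.1 he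
        rw [List.getElem?_take] at hj
        split_ifs at hj with hji
        rw [← hep]
        exact ih j hji e hj
  obtain ⟨i, hi⟩ := List.mem_iff_getElem?.1 (List.mem_of_getLast? hd)
  exact key i d hi

theorem RHS_append_left {D D' : List (Deduction Sg)} {i : ℕ} : RHS D i ⊆ RHS (D ++ D') i := by
  rintro r ⟨d, hd, rfl⟩
  exact ⟨d, by rw [List.take_append]; exact List.mem_append_left _ hd, rfl⟩

theorem IsDerivation.append {D D' : List (Deduction Sg)} (h : 𝒟.IsDerivation D)
    (h' : 𝒟.IsDerivation D') : 𝒟.IsDerivation (D ++ D') := by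
  refine ⟨fun d hd => (List.mem_append.1 hd).elim (h.1 d) (h'.1 d), fun i d hi => ?_⟩
  by_cases hlt : i < D.length
  · rw [List.getElem?_append_left hlt] at hi
    exact (h.2 i d hi).trans RHS_append_left
  · rw [List.getElem?_append_right (not_lt.1 hlt)] at hi
    rintro t ht
    obtain ⟨e, he, rfl⟩ := h'.2 _ d hi ht
    exact ⟨e, by rw [List.take_append]; exact List.mem_append_right _ he, rfl⟩

/-- Finitely many deducible terms occur together in one derivation. -/
theorem exists_derivation_of_forall_mem_Der {K A : Set (Term Sg)} (hA : A.Finite)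
    (h : ∀ t ∈ A, t ∈ 𝒟.Der K) :
    ∃ D, 𝒟.IsDerivation D ∧ (∀ r, Deduction.reception r ∈ D → r ∈ K) ∧ A ⊆ RHS D D.length := by
  induction A, hA using Set.Finite.induction_on with
  | empty => exact ⟨[], ⟨by simp, by simp⟩, by simp, by simp⟩
  | @insert a A _ _ ih =>
    obtain ⟨D, hD, hK, hAD⟩ := ih fun t ht => h t (Or.inr ht)
    obtain ⟨D', hD', hK', d, hd, rfl⟩ := h a (Or.inl rfl)
    refine ⟨D ++ D', hD.append hD', fun r hr => (List.mem_append.1 hr).elim (hK r) (hK' r), ?_⟩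
    have hall : ∀ e ∈ D ++ D', e.rhs ∈ RHS (D ++ D') (D ++ D').length :=
      fun e he => ⟨e, by rwa [List.take_length], rfl⟩
    rintro t (rfl | ht)
    · exact hall d (List.mem_append_right _ (List.mem_of_getLast? hd))
    · obtain ⟨e, he, rfl⟩ := hAD ht
      exact hall e (List.mem_append_left _ (List.mem_of_mem_take he))

theorem isGround_of_mem_Der {K : Set (Term Sg)} {t : Term Sg} (h : t ∈ 𝒟.Der K) : t.IsGround := by
  obtain ⟨D, ⟨hD, -⟩, -, d, hd, rfl⟩ := h
  have := hD d (List.mem_of_getLast? hd)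
  cases d with
  | reception t => exact this
  | standard l r => exact this.2.1

theorem mem_Der_of_instance {K : Set (Term Sg)} {R : Rule Sg} (hR : R ∈ 𝒟.standardRules)
    {ρ : Subst Sg} (h : ∀ p ∈ R.premises, p.subst ρ ∈ 𝒟.Der K) :
    R.conclusion.subst ρ ∈ 𝒟.Der K := by
  have hA : ∀ t ∈ Term.subst ρ '' R.premises, t ∈ 𝒟.Der K := by
    rintro _ ⟨p, hp, rfl⟩
    exact h p hp
  obtain ⟨D, hD, hK, hAD⟩ := exists_derivation_of_forall_mem_Der (R.premises_finite.image _) hA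
  have hground : (R.conclusion.subst ρ).IsGround := by
    refine Term.isGround_subst_iff.2 fun x hx => ?_
    obtain ⟨p, hp, hxp⟩ := mem_Vars.1 (R.vars_subset hx)
    exact Term.isGround_subst_iff.1 (isGround_of_mem_Der (h p hp)) x hxp
  refine ⟨D ++ [.standard (Term.subst ρ '' R.premises) (R.conclusion.subst ρ)], ⟨?_, ?_⟩, ?_,
    _, List.getLast?_concat, rfl⟩
  · intro d hd
    rcases List.mem_append.1 hd with hd | hd
    · exact hD.1 d hd
    · rw [List.mem_singleton.1 hd]
      exact ⟨fun t ht => isGround_of_mem_Der (hA t ht), hground, R, hR, ρ, rfl, rfl⟩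
  · intro i d hi
    by_cases hlt : i < D.length
    · rw [List.getElem?_append_left hlt] at hi
      exact (hD.2 i d hi).trans RHS_append_left
    · rw [List.getElem?_append_right (not_lt.1 hlt), List.getElem?_singleton] at hi
      split_ifs at hi with h0
      obtain rfl : i = D.length := by omega
      cases hi
      exact hAD.trans RHS_append_left
  · intro r hr
    rcases List.mem_append.1 hr with hr | hr
    · exact hK r hr
    · cases List.mem_singleton.1 hr

theorem Ded.mem_Der {G K : Set (Term Sg)} (hK : ∀ t ∈ K, t.IsGround) {t : Term Sg}
    (h : 𝒟.Ded G K t) : t ∈ 𝒟.Der K := by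
  induction h with
  | recv t ht =>
    refine ⟨[.reception t], ⟨?_, ?_⟩, ?_, _, rfl, rfl⟩
    · intro d hd
      rw [List.mem_singleton.1 hd]
      exact hK t ht
    · intro i d hi
      rw [List.getElem?_singleton] at hi
      split_ifs at hi
      cases hi
      exact Set.empty_subset _
    · intro r hr
      cases List.mem_singleton.1 hr
      exact ht
  | nonce n hn =>
    exact mem_Der_of_instance (R := nonceRule n) (ρ := .var) (Or.inr ⟨n, hn, rfl⟩)
      fun p hp => hp.elim
  | comp g ts hg _ ih =>
    obtain ⟨x, hx, hR⟩ := hg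
    have hρ : ∀ i, Function.extend x ts .var (x i) = ts i := fun i => hx.extend_apply ts _ i
    have := mem_Der_of_instance (𝒟 := 𝒟) (K := K) (R := compositionRule g x)
      (ρ := Function.extend x ts .var) (Or.inl hR) (by
        rintro _ ⟨i, rfl⟩
        simpa only [Term.subst, hρ] using ih i)
    simpa only [compositionRule, Term.subst, hρ] using this
  | dec R ρ hR _ _ _ ih => exact mem_Der_of_instance (Or.inl hR) ih

end DeductionSystem

/-! ### Abstracting deducible terms -/

/-- The ground terms sent before position `i`. -/
def sentBefore (sent : ℕ → Option (Term Sg)) (i : ℕ) : Set (Term Sg) :=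
  {t | ∃ j < i, sent j = some t}

theorem sentBefore_mono (sent : ℕ → Option (Term Sg)) {i j : ℕ} (h : i ≤ j) :
    sentBefore sent i ⊆ sentBefore sent j :=
  fun _ ⟨k, hk, hs⟩ => ⟨k, hk.trans_le h, hs⟩

theorem sentBefore_zero (sent : ℕ → Option (Term Sg)) : sentBefore sent 0 = ∅ := by
  simp [sentBefore]

theorem sentBefore_succ_of_none {sent : ℕ → Option (Term Sg)} {j : ℕ} (h : sent j = none) :
    sentBefore sent (j + 1) = sentBefore sent j := by
  refine (sentBefore_mono sent j.le_succ).antisymm' ?_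
  rintro t ⟨k, hk, ht⟩
  rcases Nat.lt_succ_iff_lt_or_eq.1 hk with hk | rfl
  · exact ⟨k, hk, ht⟩
  · rw [h] at ht; cases ht

theorem sentBefore_succ_of_some {sent : ℕ → Option (Term Sg)} {j : ℕ} {u : Term Sg}
    (h : sent j = some u) : sentBefore sent (j + 1) = insert u (sentBefore sent j) := by
  refine Set.Subset.antisymm ?_ (Set.insert_subset ⟨j, j.lt_succ_self, h⟩
    (sentBefore_mono sent j.le_succ))
  rintro t ⟨k, hk, ht⟩
  rcases Nat.lt_succ_iff_lt_or_eq.1 hk with hk | rfl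
  · exact Or.inr ⟨k, hk, ht⟩
  · rw [h] at ht; cases ht; exact Or.inl rfl

/-- A sequence of sent terms, together with a set `Z` of terms to be abstracted away. Every term
of `Z` is deducible at some point, and is deducible already before it occurs in a sent term. The
nonces `nm s` and `base` are fresh, and `f` is the symbol with a free composition rule. -/
structure Abstraction (𝒟 : DeductionSystem Sg) where
  f : Sg.Fn
  arity_f : Sg.arity f = 2
  composes_f : 𝒟.Composes f
  free_f : ∀ R ∈ 𝒟.rules, R.IsDecomposition → ¬ R.Uses f
  sent : ℕ → Option (Term Sg)
  sent_ground : ∀ j u, sent j = some u → u.IsGround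
  Z : Set (Term Sg)
  nm : Term Sg → Sg.Const
  nm_nonce : ∀ s, nm s ∈ Sg.nonces
  nm_inj : Set.InjOn nm Z
  base : Sg.Const
  base_nonce : base ∈ Sg.nonces
  nm_ne_base : ∀ s ∈ Z, nm s ≠ base
  Z_deducible : ∀ s ∈ Z, ∃ i, 𝒟.Ded Set.univ (sentBefore sent i) s
  Z_early : ∀ j u, sent j = some u → ∀ s ∈ Z, s ∈ u.subterms →
    𝒟.Ded Set.univ (sentBefore sent j) s
  sent_fresh : ∀ j u, sent j = some u →
    .const base ∉ u.subterms ∧ ∀ s ∈ Z, .const (nm s) ∉ u.subterms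

namespace Abstraction

variable {𝒟 : DeductionSystem Sg} (A : Abstraction 𝒟)

/-- The terms sent before position `i`. -/
abbrev K (i : ℕ) : Set (Term Sg) := sentBefore A.sent i

/-- The term `f(a, b)`. -/
def pair (a b : Term Sg) : Term Sg := .app A.f fun i => if i.val = 0 then a else b

/-- The first position from which the term is deducible. -/
noncomputable def stage (s : Term Sg) : ℕ := sInf {i | 𝒟.Ded Set.univ (A.K i) s}

open Classical in
/-- Every maximal occurrence of a term `s` of `Z` is replaced by `f(nm s, κ (stage s))`. -/
noncomputable def abstractWith (κ : ℕ → Term Sg) : Term Sg → Term Sg :=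
  Term.replace fun s => if s ∈ A.Z then some (A.pair (.const (A.nm s)) (κ (A.stage s))) else none

open Classical in
/-- `approx j k` is the value of the chain at `k`, for all `k ≤ j`. The chain and the abstraction
refer to each other; the members of `Z` inside the term sent at position `j` have stage at most `j`,
so abstracting that term needs the chain only up to `j`. -/
noncomputable def approx : ℕ → ℕ → Term Sg
  | 0 => fun _ => .const A.base
  | j + 1 => Function.update (approx j) (j + 1)
      (match A.sent j with
        | none => approx j j
        | some u =>
          if u ∈ A.K j then approx j j
          else A.pair (approx j j) (A.abstractWith (approx j) u))

/-- The term `f(… f(f(base, u₁), u₂) …, uₘ)` for the abstractions `u₁, …, uₘ` of the distinct terms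
sent before position `j`. It is deducible exactly when all of them are. -/
noncomputable def chain (j : ℕ) : Term Sg := A.approx j j

/-- The term that stands for `s ∈ Z`: deducible exactly from the stage of `s` on. -/
noncomputable def special (s : Term Sg) : Term Sg := A.pair (.const (A.nm s)) (A.chain (A.stage s))

/-- The abstraction of a term. -/
noncomputable def abstract (t : Term Sg) : Term Sg := A.abstractWith A.chain t

open Classical in
/-- The terms of `Z` are put back in place of the terms that stand for them. -/
noncomputable def restore : Term Sg → Term Sg :=
  Term.replace fun w => if h : ∃ s ∈ A.Z, w = A.special s then some h.choose else none

/-- The nonces introduced by the abstraction do not occur in the term. -/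
def Fresh (t : Term Sg) : Prop :=
  .const A.base ∉ t.subterms ∧ ∀ s ∈ A.Z, .const (A.nm s) ∉ t.subterms

variable {A}

theorem Fresh.of_mem_subterms {s t : Term Sg} (ht : A.Fresh t) (h : s ∈ t.subterms) : A.Fresh s :=
  ⟨fun hs => ht.1 (Term.subterms_subset h hs),
    fun z hz hs => ht.2 z hz (Term.subterms_subset h hs)⟩

variable (A)

theorem pair_inj {a b a' b' : Term Sg} (h : A.pair a b = A.pair a' b') : a = a' ∧ b = b' := by
  simp only [pair, Term.app.injEq, heq_eq_eq, true_and] at h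
  have h0 := congrFun h ⟨0, by rw [A.arity_f]; norm_num⟩
  have h1 := congrFun h ⟨1, by rw [A.arity_f]; norm_num⟩
  exact ⟨by simpa using h0, by simpa using h1⟩

theorem mem_subterms_pair {s a b : Term Sg} :
    s ∈ (A.pair a b).subterms ↔ s = A.pair a b ∨ s ∈ a.subterms ∨ s ∈ b.subterms := by
  rw [pair, Term.mem_subterms_app]
  refine or_congr_right ⟨?_, ?_⟩
  · rintro ⟨i, hi⟩
    split_ifs at hi with h
    exacts [Or.inl hi, Or.inr hi]
  · rintro (h | h)
    · exact ⟨⟨0, by rw [A.arity_f]; norm_num⟩, by simpa using h⟩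
    · exact ⟨⟨1, by rw [A.arity_f]; norm_num⟩, by simpa using h⟩

theorem ded_pair {G K : Set (Term Sg)} {a b : Term Sg} (ha : 𝒟.Ded G K a) (hb : 𝒟.Ded G K b) :
    𝒟.Ded G K (A.pair a b) := by
  refine .comp _ _ A.composes_f fun i => ?_
  split_ifs
  exacts [ha, hb]

theorem isGround_pair {a b : Term Sg} (ha : a.IsGround) (hb : b.IsGround) :
    (A.pair a b).IsGround := by
  refine Term.isGround_app fun i => ?_
  split_ifs
  exacts [ha, hb]

theorem ded_stage {s : Term Sg} (hs : s ∈ A.Z) : 𝒟.Ded Set.univ (A.K (A.stage s)) s :=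
  Nat.sInf_mem (s := {i | 𝒟.Ded Set.univ (A.K i) s}) (A.Z_deducible s hs)

theorem stage_le {s : Term Sg} {i : ℕ} (h : 𝒟.Ded Set.univ (A.K i) s) : A.stage s ≤ i :=
  Nat.sInf_le h

theorem abstractWith_of_mem (κ : ℕ → Term Sg) {s : Term Sg} (hs : s ∈ A.Z) :
    A.abstractWith κ s = A.pair (.const (A.nm s)) (κ (A.stage s)) :=
  Term.replace_of_some (by simp [hs])

theorem abstract_of_mem {s : Term Sg} (hs : s ∈ A.Z) : A.abstract s = A.special s :=
  A.abstractWith_of_mem _ hs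

theorem abstract_const {c : Sg.Const} (h : .const c ∉ A.Z) : A.abstract (.const c) = .const c := by
  rw [abstract, abstractWith, Term.replace_const_of_none (if_neg h)]

theorem abstract_app {g : Sg.Fn} {ts : Fin (Sg.arity g) → Term Sg} (h : .app g ts ∉ A.Z) :
    A.abstract (.app g ts) = .app g fun i => A.abstract (ts i) := by
  rw [abstract, abstractWith, Term.replace_app_of_none (if_neg h)]
  rfl

theorem abstract_subst {t : Term Sg} {ρ : Subst Sg}
    (h : ∀ r ∈ t.subterms, ¬ r.IsVar → r.subst ρ ∉ A.Z) :
    A.abstract (t.subst ρ) = t.subst fun x => A.abstract (ρ x) :=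
  Term.replace_subst fun r hr hv => by simp [h r hr hv]

theorem approx_of_le {j k : ℕ} (h : k ≤ j) : A.approx j k = A.chain k := by
  induction j with
  | zero => rw [Nat.le_zero.1 h]; rfl
  | succ j ih =>
    rcases Nat.le_succ_iff.1 h with h | rfl
    · rw [approx, Function.update_of_ne (by omega), ih h]
    · rfl

theorem abstractWith_approx {j : ℕ} {u : Term Sg} (h : A.sent j = some u) :
    A.abstractWith (A.approx j) u = A.abstract u := by
  refine Term.replace_congr fun s hs => ?_
  split_ifs with hZ
  · rw [A.approx_of_le (A.stage_le (A.Z_early j u h s hZ hs))]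
  · rfl

theorem chain_zero : A.chain 0 = .const A.base := rfl

theorem chain_succ_of_none {j : ℕ} (h : A.sent j = none) : A.chain (j + 1) = A.chain j := by
  simp [chain, approx, h]

theorem chain_succ_of_mem {j : ℕ} {u : Term Sg} (h : A.sent j = some u) (hu : u ∈ A.K j) :
    A.chain (j + 1) = A.chain j := by
  simp [chain, approx, h, hu]

theorem chain_succ_of_notMem {j : ℕ} {u : Term Sg} (h : A.sent j = some u) (hu : u ∉ A.K j) :
    A.chain (j + 1) = A.pair (A.chain j) (A.abstract u) := by
  simp [chain, approx, h, hu, ← A.abstractWith_approx h]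

/-- Either nothing new is sent at position `j`, or the chain grows by a link. -/
theorem chain_succ_cases (j : ℕ) :
    (A.chain (j + 1) = A.chain j ∧ A.K (j + 1) = A.K j) ∨
      ∃ u, A.sent j = some u ∧ u ∉ A.K j ∧ A.chain (j + 1) = A.pair (A.chain j) (A.abstract u) ∧
        A.K (j + 1) = insert u (A.K j) := by
  rcases h : A.sent j with _ | u
  · exact Or.inl ⟨A.chain_succ_of_none h, sentBefore_succ_of_none h⟩
  · by_cases hu : u ∈ A.K j
    · exact Or.inl ⟨A.chain_succ_of_mem h hu,
        (sentBefore_succ_of_some h).trans (Set.insert_eq_of_mem hu)⟩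
    · exact Or.inr ⟨u, rfl, hu, A.chain_succ_of_notMem h hu, sentBefore_succ_of_some h⟩

theorem isGround_abstract_of {t : Term Sg} (ht : t.IsGround) (h : ∀ j, (A.chain j).IsGround) :
    (A.abstract t).IsGround := by
  refine Term.isGround_replace ht fun s r hr => ?_
  split_ifs at hr
  cases hr
  exact A.isGround_pair (Term.isGround_const _) (h _)

theorem isGround_chain (j : ℕ) : (A.chain j).IsGround := by
  suffices h : ∀ k, (A.approx j k).IsGround from h j
  induction j with
  | zero => exact fun k => Term.isGround_const _
  | succ j ih =>
    intro k
    rw [approx, Function.update_apply]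
    split_ifs with hk
    · split
      · exact ih j
      · rename_i u hu
        split_ifs
        · exact ih j
        · refine A.isGround_pair (ih j) (Term.isGround_replace (A.sent_ground j u hu) ?_)
          intro s r hr
          split_ifs at hr
          cases hr
          exact A.isGround_pair (Term.isGround_const _) (ih _)
    · exact ih k

theorem isGround_abstract {t : Term Sg} (ht : t.IsGround) : (A.abstract t).IsGround :=
  A.isGround_abstract_of ht A.isGround_chain

theorem special_ne_const (s : Term Sg) (c : Sg.Const) : A.special s ≠ .const c := by
  simp [special, pair]

theorem chain_ne_nm {s : Term Sg} (hs : s ∈ A.Z) (j : ℕ) : A.chain j ≠ .const (A.nm s) := by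
  induction j with
  | zero =>
    rw [chain_zero]
    intro h
    exact A.nm_ne_base s hs (Term.const.inj h).symm
  | succ j ih =>
    rcases A.chain_succ_cases j with ⟨h, -⟩ | ⟨u, -, -, h, -⟩
    · rwa [h]
    · simp [h, pair]

theorem special_ne_chain {s : Term Sg} (hs : s ∈ A.Z) (j : ℕ) : A.special s ≠ A.chain j := by
  induction j with
  | zero => exact A.special_ne_const _ _
  | succ j ih =>
    rcases A.chain_succ_cases j with ⟨h, -⟩ | ⟨u, -, -, h, -⟩
    · rwa [h]
    · rw [h]
      exact fun h' => A.chain_ne_nm hs j (A.pair_inj h').1.symm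

theorem special_inj {s s' : Term Sg} (hs : s ∈ A.Z) (hs' : s' ∈ A.Z)
    (h : A.special s = A.special s') : s = s' :=
  A.nm_inj hs hs' (Term.const.inj (A.pair_inj h).1)

theorem abstract_eq_const {t : Term Sg} {c : Sg.Const} (hg : t.IsGround)
    (h : A.abstract t = .const c) : t = .const c := by
  by_cases hZ : t ∈ A.Z
  · rw [A.abstract_of_mem hZ] at h
    exact absurd h (A.special_ne_const _ _)
  · cases t with
    | var x => exact absurd (Term.mem_subterms_self _) (Term.isGround_iff.1 hg x)
    | const d => rwa [A.abstract_const hZ] at h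
    | app g ts => rw [A.abstract_app hZ] at h; cases h

theorem exists_of_abstract_eq_pair {t a b : Term Sg} (hg : t.IsGround) (hZ : t ∉ A.Z)
    (h : A.abstract t = A.pair a b) : ∃ s ∈ t.subterms, A.abstract s = a := by
  cases t with
  | var x => exact absurd (Term.mem_subterms_self _) (Term.isGround_iff.1 hg x)
  | const d => rw [A.abstract_const hZ] at h; cases h
  | app g ts =>
    rw [A.abstract_app hZ, pair] at h
    obtain ⟨rfl, h⟩ := Term.app.inj h
    refine ⟨ts ⟨0, by rw [A.arity_f]; norm_num⟩, Term.arg_mem_subterms _ _ _, ?_⟩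
    simpa using congrFun (eq_of_heq h) ⟨0, by rw [A.arity_f]; norm_num⟩

theorem abstract_ne_special {t s : Term Sg} (hg : t.IsGround) (ht : A.Fresh t) (hZ : t ∉ A.Z)
    (hs : s ∈ A.Z) : A.abstract t ≠ A.special s := by
  intro h
  obtain ⟨r, hr, hr'⟩ := A.exists_of_abstract_eq_pair hg hZ h
  exact ht.2 s hs (A.abstract_eq_const (hg.of_mem_subterms hr) hr' ▸ hr)

theorem abstract_ne_chain {t : Term Sg} (hg : t.IsGround) (ht : A.Fresh t) (j : ℕ) :
    A.abstract t ≠ A.chain j := by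
  induction j generalizing t with
  | zero => exact fun h => ht.1 (A.abstract_eq_const hg h ▸ Term.mem_subterms_self _)
  | succ j ih =>
    rcases A.chain_succ_cases j with ⟨h, -⟩ | ⟨u, -, -, h, -⟩
    · rw [h]
      exact ih hg ht
    · by_cases hZ : t ∈ A.Z
      · rw [A.abstract_of_mem hZ]
        exact A.special_ne_chain hZ _
      · rw [h]
        intro h'
        obtain ⟨r, hr, hr'⟩ := A.exists_of_abstract_eq_pair hg hZ h'
        exact ih (hg.of_mem_subterms hr) (ht.of_mem_subterms hr) hr'

theorem restore_special {s : Term Sg} (hs : s ∈ A.Z) : A.restore (A.special s) = s := by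
  have h : ∃ r ∈ A.Z, A.special s = A.special r := ⟨s, hs, rfl⟩
  rw [restore, Term.replace_of_some (r := h.choose) (by rw [dif_pos h])]
  exact (A.special_inj hs h.choose_spec.1 h.choose_spec.2).symm

theorem restore_app {g : Sg.Fn} {ts : Fin (Sg.arity g) → Term Sg}
    (h : ∀ s ∈ A.Z, Term.app g ts ≠ A.special s) :
    A.restore (.app g ts) = .app g fun i => A.restore (ts i) :=
  Term.replace_app_of_none (dif_neg fun ⟨s, hs, hs'⟩ => h s hs hs')

theorem restore_const (c : Sg.Const) : A.restore (.const c) = .const c :=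
  Term.replace_const_of_none (dif_neg fun ⟨s, _, hs'⟩ => A.special_ne_const s c hs'.symm)

theorem restore_subst {t : Term Sg} (ht : ∀ ts, Term.app A.f ts ∉ t.subterms) (ρ : Subst Sg) :
    A.restore (t.subst ρ) = t.subst fun x => A.restore (ρ x) := by
  refine Term.replace_subst fun r hr hv => dif_neg ?_
  rintro ⟨s, hs, h⟩
  cases r with
  | var x => exact hv ⟨x, rfl⟩
  | const c => exact A.special_ne_const s c h.symm
  | app g ts =>
    rw [Term.subst, special, pair] at h
    obtain ⟨rfl, -⟩ := Term.app.inj h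
    exact ht _ hr

theorem restore_abstract {t : Term Sg} (hg : t.IsGround) (ht : A.Fresh t) :
    A.restore (A.abstract t) = t := by
  induction t with
  | var x => exact absurd (Term.mem_subterms_self _) (Term.isGround_iff.1 hg x)
  | const c =>
    by_cases hZ : .const c ∈ A.Z
    · rw [A.abstract_of_mem hZ, A.restore_special hZ]
    · rw [A.abstract_const hZ, A.restore_const]
  | app g ts ih =>
    by_cases hZ : .app g ts ∈ A.Z
    · rw [A.abstract_of_mem hZ, A.restore_special hZ]
    · have hne := fun s hs => A.abstract_ne_special (s := s) hg ht hZ hs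
      rw [A.abstract_app hZ] at hne ⊢
      rw [A.restore_app hne]
      congr 1
      funext i
      have hi := Term.arg_mem_subterms g ts i
      exact ih i (hg.of_mem_subterms hi) (ht.of_mem_subterms hi)

theorem abstract_inj {t t' : Term Sg} (hg : t.IsGround) (ht : A.Fresh t) (hg' : t'.IsGround)
    (ht' : A.Fresh t') (h : A.abstract t = A.abstract t') : t = t' := by
  rw [← A.restore_abstract hg ht, h, A.restore_abstract hg' ht']

theorem K_eq_empty_of_chain_eq_const {j : ℕ} {c : Sg.Const} (h : A.chain j = .const c) :
    A.K j = ∅ := by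
  induction j with
  | zero => exact sentBefore_zero _
  | succ j ih =>
    rcases A.chain_succ_cases j with ⟨hc, hK⟩ | ⟨u, -, -, hc, -⟩
    · rw [hK]; exact ih (hc ▸ h)
    · rw [hc] at h; cases h

/-- The chain determines what has been sent. -/
theorem K_eq_of_chain_eq {j k : ℕ} (h : A.chain j = A.chain k) : A.K j = A.K k := by
  induction j generalizing k with
  | zero =>
    rw [A.K_eq_empty_of_chain_eq_const A.chain_zero, A.K_eq_empty_of_chain_eq_const h.symm]
  | succ j ih =>
    rcases A.chain_succ_cases j with ⟨hc, hK⟩ | ⟨u, hu, -, hc, hK⟩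
    · rw [hK]; exact ih (hc ▸ h)
    · induction k with
      | zero => rw [hc] at h; cases h
      | succ k ihk =>
        rcases A.chain_succ_cases k with ⟨hc', hK'⟩ | ⟨u', hu', -, hc', hK'⟩
        · rw [hK']; exact ihk (hc' ▸ h)
        · rw [hc, hc'] at h
          obtain ⟨h1, h2⟩ := A.pair_inj h
          rw [hK, hK', ih h1, A.abstract_inj (A.sent_ground j u hu) (A.sent_fresh j u hu)
            (A.sent_ground k u' hu') (A.sent_fresh k u' hu') h2]

/-! ### The abstraction reflects deducibility -/

/-- The condition on a subterm of a term deducible at stage `i` after abstraction: if it stands for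
a term of `Z` or is a link of the chain, then what it certifies is deducible at stage `i`. -/
def Sound (i : ℕ) (w : Term Sg) : Prop :=
  (∀ s ∈ A.Z, w = A.special s → 𝒟.Ded Set.univ (A.K i) s) ∧
    ∀ j, w = A.chain j → ∀ t ∈ A.K j, 𝒟.Ded Set.univ (A.K i) t

theorem sound_const (i : ℕ) (c : Sg.Const) : A.Sound i (.const c) :=
  ⟨fun s _ h => absurd h.symm (A.special_ne_const s c), fun j h t ht => by
    rw [A.K_eq_empty_of_chain_eq_const h.symm] at ht
    exact ht.elim⟩

theorem sound_subterms_special {i : ℕ} {s : Term Sg} (hs : s ∈ A.Z)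
    (h : 𝒟.Ded Set.univ (A.K i) s) (hc : ∀ w ∈ (A.chain (A.stage s)).subterms, A.Sound i w) :
    ∀ w ∈ (A.special s).subterms, A.Sound i w := by
  intro w hw
  rcases (A.mem_subterms_pair).1 hw with rfl | hw | hw
  · exact ⟨fun r hr hsr => A.special_inj hs hr hsr ▸ h,
      fun j hj => absurd hj (A.special_ne_chain hs j)⟩
  · rw [Term.subterms, Set.mem_singleton_iff] at hw
    exact hw ▸ A.sound_const i _
  · exact hc w hw

theorem sound_subterms_abstract {i : ℕ} {u : Term Sg} (hg : u.IsGround) (hu : A.Fresh u)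
    (h : ∀ s ∈ A.Z, s ∈ u.subterms → 𝒟.Ded Set.univ (A.K i) s ∧
      ∀ w ∈ (A.chain (A.stage s)).subterms, A.Sound i w) :
    ∀ w ∈ (A.abstract u).subterms, A.Sound i w := by
  induction u with
  | var x => exact absurd (Term.mem_subterms_self _) (Term.isGround_iff.1 hg x)
  | const c =>
    by_cases hZ : .const c ∈ A.Z
    · obtain ⟨h1, h2⟩ := h _ hZ (Term.mem_subterms_self _)
      exact A.abstract_of_mem hZ ▸ A.sound_subterms_special hZ h1 h2
    · intro w hw
      rw [A.abstract_const hZ, Term.subterms, Set.mem_singleton_iff] at hw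
      exact hw ▸ A.sound_const i c
  | app g ts ih =>
    by_cases hZ : .app g ts ∈ A.Z
    · obtain ⟨h1, h2⟩ := h _ hZ (Term.mem_subterms_self _)
      exact A.abstract_of_mem hZ ▸ A.sound_subterms_special hZ h1 h2
    · intro w hw
      rw [A.abstract_app hZ] at hw
      rcases Term.mem_subterms_app.1 hw with rfl | ⟨k, hk⟩
      · rw [← A.abstract_app hZ]
        exact ⟨fun s hs hw => absurd hw (A.abstract_ne_special hg hu hZ hs),
          fun j hj => absurd hj (A.abstract_ne_chain hg hu j)⟩
      · have hmem := Term.arg_mem_subterms g ts k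
        exact ih k (hg.of_mem_subterms hmem) (hu.of_mem_subterms hmem)
          (fun s hs hsk => h s hs (Term.subterms_subset hmem hsk)) w hk

theorem sound_subterms_chain {i j : ℕ} (hj : j ≤ i) :
    ∀ w ∈ (A.chain j).subterms, A.Sound i w := by
  induction j using Nat.strong_induction_on with
  | _ j ih =>
    cases j with
    | zero =>
      intro w hw
      rw [chain_zero, Term.subterms, Set.mem_singleton_iff] at hw
      exact hw ▸ A.sound_const i _
    | succ j =>
      rcases A.chain_succ_cases j with ⟨hc, -⟩ | ⟨u, hu, -, hc, -⟩
      · rw [hc]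
        exact ih j j.lt_succ_self (by omega)
      · intro w hw
        rw [hc] at hw
        rcases A.mem_subterms_pair.1 hw with rfl | hw | hw
        · rw [← hc]
          refine ⟨fun s hs h => absurd h.symm (A.special_ne_chain hs _), fun k hk t ht => ?_⟩
          rw [← A.K_eq_of_chain_eq hk] at ht
          exact .recv t (sentBefore_mono _ hj ht)
        · exact ih j j.lt_succ_self (by omega) w hw
        · refine A.sound_subterms_abstract (A.sent_ground j u hu) (A.sent_fresh j u hu) ?_ w hw
          intro s hs hsu
          have hd := A.Z_early j u hu s hs hsu
          have hle := A.stage_le hd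
          exact ⟨hd.mono (sentBefore_mono _ (by omega)), ih _ (by omega) (by omega)⟩

/-- What is deducible from the abstracted terms is, after restoring, deducible from the terms
themselves. -/
theorem ded_restore {i : ℕ} {w : Term Sg} (h : 𝒟.Ded Set.univ (A.abstract '' A.K i) w) :
    (∀ r ∈ w.subterms, A.Sound i r) ∧ 𝒟.Ded Set.univ (A.K i) (A.restore w) := by
  induction h with
  | recv w hw =>
    obtain ⟨u, hu, rfl⟩ := hw
    obtain ⟨j, hj, hju⟩ := id hu
    refine ⟨A.sound_subterms_abstract (A.sent_ground j u hju) (A.sent_fresh j u hju) ?_, ?_⟩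
    · intro s hs hsu
      have hd := A.Z_early j u hju s hs hsu
      exact ⟨hd.mono (sentBefore_mono _ hj.le),
        A.sound_subterms_chain ((A.stage_le hd).trans hj.le)⟩
    · rw [A.restore_abstract (A.sent_ground j u hju) (A.sent_fresh j u hju)]
      exact .recv u hu
  | nonce n hn =>
    refine ⟨fun r hr => ?_, ?_⟩
    · rw [Term.subterms, Set.mem_singleton_iff] at hr
      exact hr ▸ A.sound_const i n
    · rw [restore_const]
      exact .nonce n hn
  | comp g ts hg hts ih =>
    have hself : A.Sound i (.app g ts) := by
      constructor
      · -- composing the term that stands for `s` needs the chain at the stage of `s`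
        intro s hs h
        rw [special, pair] at h
        obtain ⟨rfl, h⟩ := Term.app.inj h
        have h1 := congrFun (eq_of_heq h) ⟨1, by rw [A.arity_f]; norm_num⟩
        exact (A.ded_stage hs).cut subset_rfl
          (((ih ⟨1, by rw [A.arity_f]; norm_num⟩).1 _ (Term.mem_subterms_self _)).2 _
            (by simpa using h1))
      · intro j
        induction j with
        | zero => intro h; cases h
        | succ j ihj =>
          rcases A.chain_succ_cases j with ⟨hc, hK⟩ | ⟨u, hu, -, hc, hK⟩
          · rw [hc, hK]
            exact ihj
          · intro h t ht
            rw [hc, pair] at h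
            obtain ⟨rfl, h⟩ := Term.app.inj h
            have h0 := congrFun (eq_of_heq h) ⟨0, by rw [A.arity_f]; norm_num⟩
            have h1 := congrFun (eq_of_heq h) ⟨1, by rw [A.arity_f]; norm_num⟩
            rw [hK] at ht
            rcases ht with rfl | ht
            · have := (ih ⟨1, by rw [A.arity_f]; norm_num⟩).2
              rw [h1] at this
              simpa [A.restore_abstract (A.sent_ground j t hu) (A.sent_fresh j t hu)] using this
            · exact ((ih ⟨0, by rw [A.arity_f]; norm_num⟩).1 _ (Term.mem_subterms_self _)).2 j
                (by simpa using h0) t ht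
    refine ⟨fun r hr => ?_, ?_⟩
    · rcases Term.mem_subterms_app.1 hr with rfl | ⟨k, hk⟩
      · exact hself
      · exact (ih k).1 r hk
    · by_cases h : ∃ s ∈ A.Z, Term.app g ts = A.special s
      · obtain ⟨s, hs, h⟩ := h
        rw [h, A.restore_special hs]
        exact hself.1 s hs h
      · rw [A.restore_app fun s hs hs' => h ⟨s, hs, hs'⟩]
        exact .comp g _ hg fun k => (ih k).2
  | dec R ρ hR hd _ _ ih =>
    have hfree := A.free_f R hR hd
    obtain ⟨p, hp, hrp⟩ := mem_Sub.1 hd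
    refine ⟨fun r hr => (ih p hp).1 r
      (Term.subterms_subset (Term.subst_mem_subterms hrp ρ) hr), ?_⟩
    rw [A.restore_subst fun ts hts => hfree ⟨ts, mem_Sub.2 ⟨_, Or.inl rfl, hts⟩⟩]
    refine .dec R _ hR hd trivial fun q hq => ?_
    rw [← A.restore_subst fun ts hts => hfree ⟨ts, mem_Sub.2 ⟨_, Or.inr hq, hts⟩⟩]
    exact (ih q hq).2

/-- The abstraction of an underivable term is underivable. -/
theorem ded_of_ded_abstract {i : ℕ} {t : Term Sg} (hg : t.IsGround) (ht : A.Fresh t)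
    (h : 𝒟.Ded Set.univ (A.abstract '' A.K i) (A.abstract t)) : 𝒟.Ded Set.univ (A.K i) t :=
  A.restore_abstract hg ht ▸ (A.ded_restore h).2

/-- The chain is deducible once its links have been sent. -/
theorem ded_chain (j : ℕ) : 𝒟.Ded Set.univ (A.abstract '' A.K j) (A.chain j) := by
  induction j with
  | zero => exact .nonce _ A.base_nonce
  | succ j ih =>
    rcases A.chain_succ_cases j with ⟨hc, hK⟩ | ⟨u, hu, -, hc, hK⟩
    · rwa [hc, hK]
    · rw [hc]
      refine A.ded_pair (ih.mono (Set.image_mono (sentBefore_mono _ j.le_succ))) (.recv _ ?_)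
      exact ⟨u, ⟨j, j.lt_succ_self, hu⟩, rfl⟩

theorem ded_special {i : ℕ} {s : Term Sg} (h : 𝒟.Ded Set.univ (A.K i) s) :
    𝒟.Ded Set.univ (A.abstract '' A.K i) (A.special s) :=
  A.ded_pair (.nonce _ (A.nm_nonce s))
    ((A.ded_chain _).mono (Set.image_mono (sentBefore_mono _ (A.stage_le h))))

/-! ### The size of abstracted terms -/

/-- The terms that may occur in the abstraction of a term of `H`. -/
def support (H : Set (Term Sg)) : Set (Term Sg) :=
  A.abstract '' H ∪ (fun s => .const (A.nm s)) '' A.Z ∪ Set.range A.chain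

/-- The set `H` is closed under taking the arguments of a term outside `Z`. -/
def ArgClosed (H : Set (Term Sg)) : Prop :=
  ∀ (g : Sg.Fn) (ts : Fin (Sg.arity g) → Term Sg), .app g ts ∈ H → .app g ts ∉ A.Z →
    ∀ i, ts i ∈ H

variable {A}

theorem subterms_abstract_subset_of {H : Set (Term Sg)} (hH : A.ArgClosed H) {u : Term Sg}
    (hu : u ∈ H) (hg : u.IsGround) (h : ∀ s ∈ A.Z, s ∈ u.subterms →
      (A.chain (A.stage s)).subterms ⊆ A.support H) :
    (A.abstract u).subterms ⊆ A.support H := by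
  have hspecial : ∀ s ∈ A.Z, s ∈ H → (A.chain (A.stage s)).subterms ⊆ A.support H →
      (A.abstract s).subterms ⊆ A.support H := by
    intro s hs hsH hc w hw
    rw [A.abstract_of_mem hs] at hw
    rcases A.mem_subterms_pair.1 hw with rfl | hw | hw
    · exact Or.inl (Or.inl ⟨s, hsH, A.abstract_of_mem hs⟩)
    · rw [Term.subterms, Set.mem_singleton_iff] at hw
      exact Or.inl (Or.inr ⟨s, hs, hw.symm⟩)
    · exact hc hw
  induction u with
  | var x => exact absurd (Term.mem_subterms_self _) (Term.isGround_iff.1 hg x)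
  | const c =>
    by_cases hZ : .const c ∈ A.Z
    · exact hspecial _ hZ hu (h _ hZ (Term.mem_subterms_self _))
    · intro w hw
      have hself : A.abstract (.const c) ∈ A.support H := Or.inl (Or.inl ⟨_, hu, rfl⟩)
      rw [A.abstract_const hZ] at hw hself
      rw [Term.subterms, Set.mem_singleton_iff] at hw
      exact hw ▸ hself
  | app g ts ih =>
    by_cases hZ : .app g ts ∈ A.Z
    · exact hspecial _ hZ hu (h _ hZ (Term.mem_subterms_self _))
    · intro w hw
      rw [A.abstract_app hZ] at hw
      rcases Term.mem_subterms_app.1 hw with rfl | ⟨k, hk⟩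
      · exact Or.inl (Or.inl ⟨_, hu, A.abstract_app hZ⟩)
      · have hmem := Term.arg_mem_subterms g ts k
        exact ih k (hH g ts hu hZ k) (hg.of_mem_subterms hmem)
          (fun s hs hsk => h s hs (Term.subterms_subset hmem hsk)) hk

theorem subterms_chain_subset {H : Set (Term Sg)} (hH : A.ArgClosed H)
    (hsent : ∀ j u, A.sent j = some u → u ∈ H) (j : ℕ) :
    (A.chain j).subterms ⊆ A.support H := by
  induction j using Nat.strong_induction_on with
  | _ j ih =>
    intro w hw
    cases j with
    | zero =>
      rw [chain_zero, Term.subterms, Set.mem_singleton_iff] at hw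
      exact Or.inr ⟨0, hw.symm⟩
    | succ j =>
      rcases A.chain_succ_cases j with ⟨hc, -⟩ | ⟨u, hu, -, hc, -⟩
      · rw [hc] at hw
        exact ih j j.lt_succ_self hw
      · rw [hc] at hw
        rcases A.mem_subterms_pair.1 hw with rfl | hw | hw
        · exact Or.inr ⟨j + 1, hc⟩
        · exact ih j j.lt_succ_self hw
        · refine subterms_abstract_subset_of hH (hsent j u hu) (A.sent_ground j u hu) ?_ hw
          intro s hs hsu
          exact ih _ (Nat.lt_succ_of_le (A.stage_le (A.Z_early j u hu s hs hsu)))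

theorem subterms_abstract_subset {H : Set (Term Sg)} (hH : A.ArgClosed H)
    (hsent : ∀ j u, A.sent j = some u → u ∈ H) {u : Term Sg} (hu : u ∈ H) (hg : u.IsGround) :
    (A.abstract u).subterms ⊆ A.support H :=
  subterms_abstract_subset_of hH hu hg fun _ _ _ => subterms_chain_subset hH hsent _

/-- The chain takes a new value only when a term is sent for the first time. -/
theorem range_chain_subset :
    Set.range A.chain ⊆ insert (.const A.base)
      ((fun u => A.chain (sInf {j | A.sent j = some u} + 1)) '' {u | ∃ j, A.sent j = some u}) := by
  rintro _ ⟨j, rfl⟩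
  induction j with
  | zero => exact Or.inl rfl
  | succ j ih =>
    rcases A.chain_succ_cases j with ⟨hc, -⟩ | ⟨u, hu, hnew, -, -⟩
    · rwa [hc]
    · refine Or.inr ⟨u, ⟨j, hu⟩, ?_⟩
      have hj : sInf {k | A.sent k = some u} = j := by
        refine le_antisymm (Nat.sInf_le hu) (not_lt.1 fun hlt => hnew ?_)
        exact ⟨_, hlt, Nat.sInf_mem (s := {k | A.sent k = some u}) ⟨j, hu⟩⟩
      simp only [hj]

theorem encard_support_le {H : Set (Term Sg)} (hsent : ∀ j u, A.sent j = some u → u ∈ H)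
    (hZ : A.Z ⊆ H) : (A.support H).encard ≤ 3 * H.encard + 1 := by
  have h1 : (A.abstract '' H).encard ≤ H.encard := Set.encard_image_le _ _
  have h2 : ((fun s => Term.const (A.nm s) : Term Sg → Term Sg) '' A.Z).encard ≤ H.encard :=
    (Set.encard_image_le _ _).trans (Set.encard_le_encard hZ)
  have h3 : (Set.range A.chain).encard ≤ H.encard + 1 := by
    refine (Set.encard_le_encard range_chain_subset).trans ((Set.encard_insert_le _ _).trans ?_)
    refine add_le_add ?_ le_rfl
    refine (Set.encard_image_le _ _).trans (Set.encard_le_encard ?_)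
    rintro u ⟨j, hj⟩
    exact hsent j u hj
  calc (A.support H).encard ≤ H.encard + H.encard + (H.encard + 1) :=
        (Set.encard_union_le _ _).trans
          (add_le_add ((Set.encard_union_le _ _).trans (add_le_add h1 h2)) h3)
    _ = 3 * H.encard + 1 := by ring

end Abstraction

/-! ### Locality: few decompositions suffice -/

namespace DeductionSystem

variable {𝒟 : DeductionSystem Sg}

theorem Ded.subterm {G K : Set (Term Sg)}
    (hK : ∀ u ∈ K, ∀ s ∈ u.subterms, s ∈ G ∨ 𝒟.Ded G K s) {t : Term Sg} (h : 𝒟.Ded G K t) :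
    ∀ s ∈ t.subterms, s ∈ G ∨ 𝒟.Ded G K s := by
  induction h with
  | recv t ht => exact hK t ht
  | nonce n hn =>
    intro s hs
    rw [Term.subterms, Set.mem_singleton_iff] at hs
    exact Or.inr (hs ▸ .nonce n hn)
  | comp g ts hg hts ih =>
    intro s hs
    rcases Term.mem_subterms_app.1 hs with rfl | ⟨i, hi⟩
    · exact Or.inr (.comp g ts hg hts)
    · exact ih i s hi
  | dec R ρ hR hd hG hp ih =>
    intro s hs
    obtain ⟨p, hp, hrp⟩ := mem_Sub.1 hd
    exact ih p hp s (Term.subterms_subset (Term.subst_mem_subterms hrp ρ) hs)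

/-- If every subterm of `K` outside `G` is deducible, then decompositions with a conclusion outside
`G` are superfluous. -/
theorem Ded.restrict {G K : Set (Term Sg)}
    (hK : ∀ u ∈ K, ∀ s ∈ u.subterms, s ∈ G ∨ 𝒟.Ded G K s) {t : Term Sg}
    (h : 𝒟.Ded Set.univ K t) : 𝒟.Ded G K t := by
  induction h with
  | recv t ht => exact .recv t ht
  | nonce n hn => exact .nonce n hn
  | comp g ts hg _ ih => exact .comp g ts hg ih
  | dec R ρ hR hd _ _ ih =>
    obtain ⟨p, hp, hrp⟩ := mem_Sub.1 hd
    rcases (ih p hp).subterm hK _ (Term.subst_mem_subterms hrp ρ) with h | h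
    · exact .dec R ρ hR hd h ih
    · exact h

/-- Every subterm of a sent term lies in `G` or in a term that was deducible when it was sent. -/
def Originates (𝒟 : DeductionSystem Sg) (G : Set (Term Sg)) (sent : ℕ → Option (Term Sg)) : Prop :=
  ∀ j u, sent j = some u → ∀ s ∈ u.subterms,
    s ∈ G ∨ ∃ t, 𝒟.Ded Set.univ (sentBefore sent j) t ∧ s ∈ t.subterms

theorem Originates.subterm_sentBefore {G : Set (Term Sg)} {sent : ℕ → Option (Term Sg)}
    (hs : 𝒟.Originates G sent) (i : ℕ) :
    ∀ u ∈ sentBefore sent i, ∀ s ∈ u.subterms, s ∈ G ∨ 𝒟.Ded G (sentBefore sent i) s := by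
  induction i using Nat.strong_induction_on with
  | _ i ih =>
    rintro u ⟨j, hj, hu⟩ s hsu
    rcases hs j u hu s hsu with h | ⟨t, ht, hst⟩
    · exact Or.inl h
    · exact ((ht.restrict (ih j hj)).subterm (ih j hj) s hst).imp_right
        fun h => h.mono (sentBefore_mono sent hj.le)

theorem Originates.ded_restrict {G : Set (Term Sg)} {sent : ℕ → Option (Term Sg)}
    (hs : 𝒟.Originates G sent) {i : ℕ} {t : Term Sg} (h : 𝒟.Ded Set.univ (sentBefore sent i) t) :
    𝒟.Ded G (sentBefore sent i) t :=
  h.restrict (hs.subterm_sentBefore i)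

theorem Originates.ded_subterm {G : Set (Term Sg)} {sent : ℕ → Option (Term Sg)}
    (hs : 𝒟.Originates G sent) {i : ℕ} {s t : Term Sg}
    (h : 𝒟.Ded Set.univ (sentBefore sent i) t) (hst : s ∈ t.subterms) (hG : s ∉ G) :
    𝒟.Ded Set.univ (sentBefore sent i) s :=
  (((hs.ded_restrict h).subterm (hs.subterm_sentBefore i) s hst).resolve_left hG).cut
    (Set.subset_univ G) fun t ht => .recv t ht

theorem Originates.ded_subterm_sent {G : Set (Term Sg)} {sent : ℕ → Option (Term Sg)}
    (hs : 𝒟.Originates G sent) {j : ℕ} {s u : Term Sg} (hu : sent j = some u)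
    (hsu : s ∈ u.subterms) (hG : s ∉ G) : 𝒟.Ded Set.univ (sentBefore sent j) s := by
  obtain ⟨t, ht, hst⟩ := (hs j u hu s hsu).resolve_left hG
  exact hs.ded_subterm ht hst hG

variable (𝒟) in
/-- `𝒟.Ded G K` with a bound on the height of the deduction tree. -/
inductive DedWithin (G K : Set (Term Sg)) : ℕ → Term Sg → Prop
  | recv (h : ℕ) (t : Term Sg) : t ∈ K → DedWithin G K h t
  | nonce (h : ℕ) (n : Sg.Const) : n ∈ Sg.nonces → DedWithin G K h (.const n)
  | comp (h : ℕ) (g : Sg.Fn) (ts : Fin (Sg.arity g) → Term Sg) :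
      𝒟.Composes g → (∀ i, DedWithin G K h (ts i)) → DedWithin G K (h + 1) (.app g ts)
  | dec (h : ℕ) (R : Rule Sg) (ρ : Subst Sg) :
      R ∈ 𝒟.rules → R.IsDecomposition → R.conclusion.subst ρ ∈ G →
      (∀ p ∈ R.premises, DedWithin G K h (p.subst ρ)) → DedWithin G K (h + 1) (R.conclusion.subst ρ)

theorem DedWithin.ded {G K : Set (Term Sg)} {h : ℕ} {t : Term Sg} (ht : 𝒟.DedWithin G K h t) :
    𝒟.Ded G K t := by
  induction ht with
  | recv h t ht => exact .recv t ht
  | nonce h n hn => exact .nonce n hn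
  | comp h g ts hg _ ih => exact .comp g ts hg ih
  | dec h R ρ hR hd hG _ ih => exact .dec R ρ hR hd hG ih

theorem DedWithin.mono {G K : Set (Term Sg)} {h h' : ℕ} (hh : h ≤ h') {t : Term Sg}
    (ht : 𝒟.DedWithin G K h t) : 𝒟.DedWithin G K h' t := by
  induction ht generalizing h' with
  | recv h t ht => exact .recv h' t ht
  | nonce h n hn => exact .nonce h' n hn
  | comp h g ts hg _ ih =>
    obtain ⟨k, rfl⟩ : ∃ k, h' = k + 1 := ⟨h' - 1, by omega⟩
    exact .comp k g ts hg fun i => ih i (by omega)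
  | dec h R ρ hR hd hG _ ih =>
    obtain ⟨k, rfl⟩ : ∃ k, h' = k + 1 := ⟨h' - 1, by omega⟩
    exact .dec k R ρ hR hd hG fun p hp => ih p hp (by omega)

/-- Finitely many terms are deducible within a common height. -/
theorem exists_forall_dedWithin {ι : Type*} {s : Set ι} (hs : s.Finite) {G K : Set (Term Sg)}
    {t : ι → Term Sg} (h : ∀ i ∈ s, ∃ k, 𝒟.DedWithin G K k (t i)) :
    ∃ k, ∀ i ∈ s, 𝒟.DedWithin G K k (t i) := by
  choose! k hk using h
  obtain ⟨m, hm⟩ := (hs.image k).bddAbove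
  exact ⟨m, fun i hi => (hk i hi).mono (hm ⟨i, hi, rfl⟩)⟩

theorem Ded.exists_dedWithin {G K : Set (Term Sg)} {t : Term Sg} (ht : 𝒟.Ded G K t) :
    ∃ h, 𝒟.DedWithin G K h t := by
  induction ht with
  | recv t ht => exact ⟨0, .recv 0 t ht⟩
  | nonce n hn => exact ⟨0, .nonce 0 n hn⟩
  | comp g ts hg _ ih =>
    obtain ⟨k, hk⟩ := exists_forall_dedWithin Set.finite_univ fun i _ => ih i
    exact ⟨k + 1, .comp k g ts hg fun i => hk i trivial⟩
  | dec R ρ hR hd hG _ ih =>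
    obtain ⟨k, hk⟩ := exists_forall_dedWithin R.premises_finite ih
    exact ⟨k + 1, .dec k R ρ hR hd hG hk⟩

/-- The term is deduced for the first time at position `i` with height `h`, in the lexicographic
order on positions and heights. -/
def FirstDeduced (𝒟 : DeductionSystem Sg) (G : Set (Term Sg)) (sent : ℕ → Option (Term Sg))
    (s : Term Sg) (i h : ℕ) : Prop :=
  𝒟.DedWithin G (sentBefore sent i) h s ∧
    (∀ i' < i, ∀ h', ¬ 𝒟.DedWithin G (sentBefore sent i') h' s) ∧
    ∀ h' < h, ¬ 𝒟.DedWithin G (sentBefore sent i) h' s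

theorem FirstDeduced.unique {G : Set (Term Sg)} {sent : ℕ → Option (Term Sg)} {s : Term Sg}
    {i h i' h' : ℕ} (H : 𝒟.FirstDeduced G sent s i h) (H' : 𝒟.FirstDeduced G sent s i' h') :
    i = i' ∧ h = h' := by
  obtain rfl : i = i' := by
    rcases lt_trichotomy i i' with hlt | rfl | hlt
    · exact absurd H.1 (H'.2.1 i hlt h)
    · rfl
    · exact absurd H'.1 (H.2.1 i' hlt h')
  refine ⟨rfl, ?_⟩
  rcases lt_trichotomy h h' with hlt | rfl | hlt
  · exact absurd H.1 (H'.2.2 h hlt)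
  · rfl
  · exact absurd H'.1 (H.2.2 h' hlt)

/-- The instance `q` of a decomposition rule yields `s` from premises deducible at position `i`
within height `h`. -/
def Decomposes (𝒟 : DeductionSystem Sg) (G : Set (Term Sg)) (sent : ℕ → Option (Term Sg))
    (i h : ℕ) (s : Term Sg) (q : Rule Sg × Subst Sg) : Prop :=
  q.1 ∈ 𝒟.rules ∧ q.1.IsDecomposition ∧ q.1.conclusion.subst q.2 = s ∧
    ∀ p ∈ q.1.premises, 𝒟.DedWithin G (sentBefore sent i) h (p.subst q.2)

/-- A set of at most `|G|` decompositions provides, for each term of `G` that can be obtained by a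
decomposition when it is deduced first, such a decomposition. -/
theorem exists_decompositions (𝒟 : DeductionSystem Sg) (G : Set (Term Sg))
    (sent : ℕ → Option (Term Sg)) :
    ∃ I : Set (Rule Sg × Subst Sg), I.encard ≤ G.encard ∧
      (∀ q ∈ I, ∃ i h s, 𝒟.Decomposes G sent i h s q) ∧
      ∀ s ∈ G, ∀ i h, 𝒟.FirstDeduced G sent s i (h + 1) → (∃ q, 𝒟.Decomposes G sent i h s q) →
        ∃ q ∈ I, 𝒟.Decomposes G sent i h s q := by
  let P : Term Sg → Prop :=
    fun s => ∃ i h, 𝒟.FirstDeduced G sent s i (h + 1) ∧ ∃ q, 𝒟.Decomposes G sent i h s q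
  have hch : ∀ s, ∃ q, P s →
      ∃ i h, 𝒟.FirstDeduced G sent s i (h + 1) ∧ 𝒟.Decomposes G sent i h s q := by
    intro s
    by_cases hs : P s
    · obtain ⟨i, h, hf, q, hq⟩ := hs
      exact ⟨q, fun _ => ⟨i, h, hf, hq⟩⟩
    · exact ⟨(nonceRule Sg.nonces_infinite.nonempty.some, .var), fun h => absurd h hs⟩
  choose inst hinst using hch
  refine ⟨inst '' {s ∈ G | P s}, ?_, ?_, ?_⟩
  · exact (Set.encard_image_le _ _).trans (Set.encard_le_encard (Set.sep_subset _ _))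
  · rintro _ ⟨s, ⟨-, hs⟩, rfl⟩
    obtain ⟨i, h, -, hq⟩ := hinst s hs
    exact ⟨i, h, s, hq⟩
  · intro s hs i h hf hq
    have hP : P s := ⟨i, h, hf, hq⟩
    obtain ⟨i', h', hf', hq'⟩ := hinst s hP
    obtain ⟨rfl, hh⟩ := hf.unique hf'
    obtain rfl : h = h' := by omega
    exact ⟨_, ⟨s, ⟨hs, hP⟩, rfl⟩, hq'⟩

end DeductionSystem

/-! ### The abstraction preserves deducibility -/

namespace Abstraction

variable {𝒟 : DeductionSystem Sg} (A : Abstraction 𝒟)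

/-- If none of the terms of `Z` is an instance of a non-variable subterm of the chosen
decompositions, then deductions from the sent terms survive the abstraction. -/
theorem ded_abstract {G H : Set (Term Sg)} {I : Set (Rule Sg × Subst Sg)}
    (hsent : 𝒟.Originates G A.sent)
    (hI : ∀ s ∈ G, ∀ i h, 𝒟.FirstDeduced G A.sent s i (h + 1) →
      (∃ q, 𝒟.Decomposes G A.sent i h s q) → ∃ q ∈ I, 𝒟.Decomposes G A.sent i h s q)
    (hIZ : ∀ q ∈ I, ∀ r ∈ Sub q.1.premises, ¬ r.IsVar → r.subst q.2 ∉ A.Z)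
    (hIH : ∀ q ∈ I, ∀ p ∈ q.1.premises, p.subst q.2 ∈ H)
    (hH : A.ArgClosed H) {i : ℕ} {s : Term Sg} (hs : s ∈ H)
    (h : 𝒟.Ded Set.univ (A.K i) s) :
    𝒟.Ded Set.univ (A.abstract '' A.K i) (A.abstract s) := by
  obtain ⟨k, hk⟩ := (hsent.ded_restrict h).exists_dedWithin
  clear h
  induction i using Nat.strong_induction_on generalizing s k with
  | _ i ihi =>
  induction k using Nat.strong_induction_on generalizing s with
  | _ k ihk =>
  by_cases hZ : s ∈ A.Z
  · rw [A.abstract_of_mem hZ]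
    exact A.ded_special (hk.ded.cut (Set.subset_univ G) fun t ht => .recv t ht)
  by_cases hi : ∃ i' < i, ∃ h', 𝒟.DedWithin G (A.K i') h' s
  · obtain ⟨i', hi', h', hd⟩ := hi
    exact (ihi i' hi' hs h' hd).mono (Set.image_mono (sentBefore_mono _ hi'.le))
  by_cases hh : ∃ h' < k, 𝒟.DedWithin G (A.K i) h' s
  · obtain ⟨h', hh', hd⟩ := hh
    exact ihk h' hh' hs hd
  have hfirst : 𝒟.FirstDeduced G A.sent s i k :=
    ⟨hk, fun i' hi' h' hd => hi ⟨i', hi', h', hd⟩, fun h' hh' hd => hh ⟨h', hh', hd⟩⟩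
  cases hk with
  | recv _ _ ht => exact .recv _ ⟨s, ht, rfl⟩
  | nonce _ n hn =>
    rw [A.abstract_const hZ]
    exact .nonce n hn
  | comp h g ts hg hts =>
    rw [A.abstract_app hZ]
    exact .comp g _ hg fun j => ihk h h.lt_succ_self (hH g ts hs hZ j) (hts j)
  | dec h R ρ hR hd hG hp =>
    obtain ⟨⟨R', ρ'⟩, hq, hR', hd', he, hp'⟩ := hI _ hG i h hfirst ⟨(R, ρ), hR, hd, rfl, hp⟩
    dsimp only at hR' hd' he hp'
    have hsub : ∀ t ∈ Sub R'.premises,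
        A.abstract (t.subst ρ') = t.subst fun x => A.abstract (ρ' x) := fun t ht =>
      A.abstract_subst fun r hr hv => hIZ _ hq r (mem_Sub_of_mem_subterms ht hr) hv
    rw [← he, hsub _ hd']
    refine .dec R' _ hR' hd' trivial fun p hpm => ?_
    rw [← hsub p (subset_Sub _ hpm)]
    exact ihk h h.lt_succ_self (hIH _ hq p hpm) (hp' p hpm)

end Abstraction

/-! ### Solutions of constraint systems -/

namespace ConstraintSystem

variable (S : ConstraintSystem Sg) {𝒟 : DeductionSystem Sg} {σ : Subst Sg}

/-- The instance of the term sent at position `j`, if any. -/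
def sent (S : ConstraintSystem Sg) (σ : Subst Sg) (j : ℕ) : Option (Term Sg) :=
  match S.constraints[j]? with
  | some (.snd t) => some (t.subst σ)
  | _ => none

theorem sent_eq_some_iff {j : ℕ} {u : Term Sg} :
    S.sent σ j = some u ↔ ∃ t, S.constraints[j]? = some (.snd t) ∧ u = t.subst σ := by
  unfold sent
  split
  · rename_i t ht
    simp [ht, eq_comm]
  · rename_i h
    simp only [reduceCtorEq, false_iff]
    rintro ⟨t, ht, -⟩
    exact h t ht

theorem knowledge_eq (i : ℕ) : S.knowledge σ i = sentBefore (S.sent σ) (i + 1) := by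
  ext u
  simp only [knowledge, sentBefore, sent_eq_some_iff, Nat.lt_succ_iff, Set.mem_ofPred_eq]

/-- The instances of the non-variable subterms of the constraints. -/
def instances (σ : Subst Sg) : Set (Term Sg) :=
  {s | ∃ r ∈ Sub S.terms, ¬ r.IsVar ∧ s = r.subst σ}

variable {S}

theorem mem_terms {j : ℕ} {c : Constraint Sg} (h : S.constraints[j]? = some c) :
    c.term ∈ S.terms :=
  ⟨c, List.mem_of_getElem? h, rfl⟩

theorem var_mem_Sub {x : Sg.Var} (hx : x ∈ Vars S.terms) : .var x ∈ Sub S.terms := by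
  obtain ⟨t, ht, hxt⟩ := mem_Vars.1 hx
  exact mem_Sub.2 ⟨t, ht, hxt⟩

theorem mem_Vars_of_mem_Sub {t : Term Sg} (ht : t ∈ Sub S.terms) {x : Sg.Var} (hx : x ∈ t.vars) :
    x ∈ Vars S.terms := by
  obtain ⟨r, hr, htr⟩ := mem_Sub.1 ht
  exact mem_Vars.2 ⟨r, hr, Term.subterms_subset htr hx⟩

/-- Every variable occurs in a received term. -/
theorem exists_rcv {x : Sg.Var} (hx : x ∈ Vars S.terms) :
    ∃ (j : ℕ) (t : Term Sg), S.constraints[j]? = some (.rcv t) ∧ x ∈ t.vars := by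
  obtain ⟨_, ⟨c, hc, rfl⟩, hxc⟩ := mem_Vars.1 hx
  obtain ⟨i, hi⟩ := List.mem_iff_getElem?.1 hc
  cases c with
  | rcv t => exact ⟨i, t, hi, hxc⟩
  | snd t =>
    obtain ⟨s, ⟨j, -, hj⟩, hxs⟩ := mem_Vars.1 (S.origination i t hi hxc)
    exact ⟨j, s, hj, hxs⟩
  | forbid t =>
    obtain ⟨s, ⟨j, hj⟩, hxs⟩ := mem_Vars.1 (S.determination i t hi hxc)
    exact ⟨j, s, hj, hxs⟩

theorem IsSolution.isGround_subst (hσ : S.IsSolution 𝒟 σ) {t : Term Sg} (ht : t ∈ Sub S.terms) :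
    (t.subst σ).IsGround :=
  Term.isGround_subst_iff.2 fun x hx => hσ.ground x (by
    rw [hσ.dom_eq]
    exact mem_Vars_of_mem_Sub ht hx)

theorem snd_mem_Sub {j : ℕ} {t : Term Sg} (h : S.constraints[j]? = some (.snd t)) :
    t ∈ Sub S.terms :=
  subset_Sub _ (mem_terms h)

theorem IsSolution.isGround_sent (hσ : S.IsSolution 𝒟 σ) {j : ℕ} {u : Term Sg}
    (h : S.sent σ j = some u) : u.IsGround := by
  obtain ⟨t, ht, rfl⟩ := S.sent_eq_some_iff.1 h
  exact hσ.isGround_subst (snd_mem_Sub ht)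

theorem IsSolution.ded_rcv (hσ : S.IsSolution 𝒟 σ) (hsub : 𝒟.IsSubterm) {j : ℕ} {t : Term Sg}
    (h : S.constraints[j]? = some (.rcv t)) :
    𝒟.Ded Set.univ (sentBefore (S.sent σ) (j + 1)) (t.subst σ) := by
  rw [← S.knowledge_eq]
  exact .of_mem_Der hsub (hσ.rcv j t h)

/-- A subterm of a sent term is an instance of a non-variable subterm of the constraints, or occurs
in a term received, and hence deducible, before. -/
theorem IsSolution.originates (hσ : S.IsSolution 𝒟 σ) (hsub : 𝒟.IsSubterm) :
    𝒟.Originates (S.instances σ) (S.sent σ) := by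
  intro j u hu s hs
  obtain ⟨t, ht, rfl⟩ := S.sent_eq_some_iff.1 hu
  rcases Term.mem_subterms_subst hs with ⟨r, hr, hv, rfl⟩ | ⟨x, hx, hsx⟩
  · exact Or.inl ⟨r, mem_Sub_of_mem_subterms (snd_mem_Sub ht) hr, hv, rfl⟩
  · obtain ⟨t', ⟨k, hk, hkt⟩, hxt⟩ := mem_Vars.1 (S.origination j t ht hx)
    exact Or.inr ⟨_, (hσ.ded_rcv hsub hkt).mono (sentBefore_mono _ hk),
      Term.subterms_subset (Term.subst_mem_subterms (t := t') hxt σ) hsx⟩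

end ConstraintSystem

/-- Fresh names for the members of a finite set, and one more. -/
theorem exists_fresh_nonces {B : Set Sg.Const} (hB : B.Finite) {Z : Set (Term Sg)}
    (hZ : Z.Finite) :
    ∃ (nm : Term Sg → Sg.Const) (base : Sg.Const), (∀ s, nm s ∈ Sg.nonces \ B) ∧ Set.InjOn nm Z ∧
      base ∈ Sg.nonces \ B ∧ ∀ s ∈ Z, nm s ≠ base := by
  let e := (Sg.nonces_infinite.sdiff hB).natEmbedding
  obtain ⟨k, hk⟩ := Set.countable_iff_exists_injOn.1 hZ.countable
  refine ⟨fun s => e (k s + 1), e 0, fun s => (e _).2, fun s hs s' hs' h => ?_, (e 0).2,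
    fun s _ h => ?_⟩
  · exact hk hs hs' (Nat.succ_injective (e.injective (Subtype.ext h)))
  · exact Nat.succ_ne_zero _ (e.injective (Subtype.ext h))

namespace DeductionSystem

variable {𝒟 : DeductionSystem Sg}

theorem HasFreeBinaryComposition.exists_symbol (h : 𝒟.HasFreeBinaryComposition) :
    ∃ f, Sg.arity f = 2 ∧ 𝒟.Composes f ∧ ∀ R ∈ 𝒟.rules, R.IsDecomposition → ¬ R.Uses f := by
  obtain ⟨f, x, h2, hx, hR, hfree⟩ := h
  refine ⟨f, h2, ⟨x, hx, ?_⟩, fun R hR hd => hfree R (Or.inl hR) ?_⟩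
  · rcases hR with hR | ⟨n, -, hR⟩
    · exact hR
    · cases congrArg Rule.conclusion hR
  · rintro rfl
    obtain ⟨_, ⟨i, rfl⟩, hi⟩ := mem_Sub.1 hd
    rw [Term.subterms, Set.mem_singleton_iff] at hi
    cases hi

theorem exists_encard_Sub_premises_le (𝒟 : DeductionSystem Sg) :
    ∃ M : ℕ, ∀ R ∈ 𝒟.rules, (Sub R.premises).encard ≤ M := by
  obtain ⟨M, hM⟩ := (𝒟.rules_finite.image fun R => (Sub R.premises).ncard).bddAbove
  refine ⟨M, fun R hR => ?_⟩
  rw [← (Sub_finite R.premises_finite).cast_ncard_eq]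
  exact_mod_cast hM ⟨R, hR, rfl⟩

end DeductionSystem

theorem encard_biUnion_le_mul {α β : Type*} {I : Set α} (hI : I.Finite) (s : α → Set β) {M : ℕ∞}
    (h : ∀ i ∈ I, (s i).encard ≤ M) : (⋃ i ∈ I, s i).encard ≤ I.encard * M := by
  induction I, hI using Set.Finite.induction_on with
  | empty => simp
  | @insert a I ha _ ih =>
    rw [Set.biUnion_insert, Set.encard_insert_of_notMem ha, add_mul, one_mul, add_comm]
    exact (Set.encard_union_le _ _).trans
      (add_le_add (h a (Or.inl rfl)) (ih fun i hi => h i (Or.inr hi)))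

/-- A solvable constraint system has a solution of size linear in the number of its subterms. -/
theorem ConstraintSystem.IsSolution.exists_small {𝒟 : DeductionSystem Sg} (hsub : 𝒟.IsSubterm)
    (hfree : 𝒟.HasFreeBinaryComposition) {M : ℕ}
    (hM : ∀ R ∈ 𝒟.rules, (Sub R.premises).encard ≤ M) {S : ConstraintSystem Sg} {σ : Subst Sg}
    (hσ : S.IsSolution 𝒟 σ) (hfin : (Sub S.terms).Finite) :
    ∃ τ, S.IsSolution 𝒟 τ ∧ τ.size ≤ (4 + 3 * M) * (Sub S.terms).encard + 1 := by
  obtain ⟨f, hf2, hfc, hff⟩ := hfree.exists_symbol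
  set G := S.instances σ with hG
  have horig : 𝒟.Originates G (S.sent σ) := hσ.originates hsub
  have hGσ : G ⊆ Term.subst σ '' Sub S.terms := by
    rintro _ ⟨r, hr, -, rfl⟩
    exact ⟨r, hr, rfl⟩
  obtain ⟨I, hIcard, hIdec, hI⟩ := 𝒟.exists_decompositions G (S.sent σ)
  have hIN : I.encard ≤ (Sub S.terms).encard :=
    hIcard.trans ((Set.encard_le_encard hGσ).trans (Set.encard_image_le _ _))
  have hIfin : I.Finite := Set.finite_of_encard_le_coe
    (hIN.trans_eq hfin.cast_ncard_eq.symm)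
  -- `H` holds the instances of all subterms of the constraints and of the chosen decompositions;
  -- `Z` holds those that are instances of variables only, so that no step looks inside them.
  let aux : Set (Term Sg) := ⋃ q ∈ I, Term.subst q.2 '' Sub q.1.premises
  let rigid : Set (Term Sg) :=
    {s | ∃ q ∈ I, ∃ r ∈ Sub q.1.premises, ¬ r.IsVar ∧ s = r.subst q.2}
  let H : Set (Term Sg) := Term.subst σ '' Sub S.terms ∪ aux
  let Z : Set (Term Sg) := H \ (G ∪ rigid)
  have hmem_aux : ∀ {s}, s ∈ aux ↔ ∃ q ∈ I, ∃ r ∈ Sub q.1.premises, r.subst q.2 = s := by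
    intro s
    simp [aux]
  have haux : aux.encard ≤ (Sub S.terms).encard * M := by
    refine (encard_biUnion_le_mul hIfin _ fun q hq => ?_).trans (mul_le_mul_left hIN _)
    obtain ⟨i, h, s, hq⟩ := hIdec q hq
    exact (Set.encard_image_le _ _).trans (hM _ hq.1)
  have hHcard : H.encard ≤ (1 + M) * (Sub S.terms).encard := by
    refine (Set.encard_union_le _ _).trans
      ((add_le_add (Set.encard_image_le _ _) haux).trans_eq ?_)
    ring
  have hauxfin : aux.Finite :=
    hIfin.biUnion fun q _ => (Sub_finite q.1.premises_finite).image _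
  have hHfin : H.Finite := (hfin.image _).union hauxfin
  have hsentH : ∀ j u, S.sent σ j = some u → u ∈ H := by
    intro j u hu
    obtain ⟨t, ht, rfl⟩ := S.sent_eq_some_iff.1 hu
    exact Or.inl ⟨t, snd_mem_Sub ht, rfl⟩
  have hZded : ∀ s ∈ Z, ∃ i, 𝒟.Ded Set.univ (sentBefore (S.sent σ) i) s := by
    rintro s ⟨hs | hs, hsG⟩
    · obtain ⟨r, hr, rfl⟩ := hs
      by_cases hv : r.IsVar
      · obtain ⟨x, rfl⟩ := hv
        obtain ⟨j, t, hj, hxt⟩ := exists_rcv (mem_Vars_of_mem_Sub hr (Term.mem_subterms_self _))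
        exact ⟨_, horig.ded_subterm (hσ.ded_rcv hsub hj)
          (Term.subst_mem_subterms (t := t) hxt σ) fun h => hsG (Or.inl h)⟩
      · exact absurd (Or.inl ⟨r, hr, hv, rfl⟩) hsG
    · obtain ⟨q, hq, r, hr, rfl⟩ := hmem_aux.1 hs
      obtain ⟨i, h, s, hq'⟩ := hIdec q hq
      obtain ⟨p, hp, hrp⟩ := mem_Sub.1 hr
      exact ⟨i, horig.ded_subterm
        ((hq'.2.2.2 p hp).ded.cut (Set.subset_univ G) fun t ht => .recv t ht)
        (Term.subst_mem_subterms hrp _) fun h => hsG (Or.inl h)⟩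
  have hBfin : {c | .const c ∈ Sub H}.Finite :=
    (Sub_finite hHfin).preimage (f := Term.const) fun c _ d _ h => Term.const.inj h
  obtain ⟨nm, base, hnm, hinj, hbase, hne⟩ :=
    exists_fresh_nonces hBfin (hHfin.sdiff (t := G ∪ rigid))
  have hfresh : ∀ u ∈ H, .const base ∉ u.subterms ∧ ∀ s ∈ Z, .const (nm s) ∉ u.subterms :=
    fun u hu => ⟨fun h => hbase.2 (mem_Sub.2 ⟨u, hu, h⟩),
      fun s _ h => (hnm s).2 (mem_Sub.2 ⟨u, hu, h⟩)⟩
  let A : Abstraction 𝒟 :=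
    { f := f, arity_f := hf2, composes_f := hfc, free_f := hff
      sent := S.sent σ
      sent_ground := fun j u hu => hσ.isGround_sent hu
      Z := Z, nm := nm, base := base
      nm_nonce := fun s => (hnm s).1
      nm_inj := hinj
      base_nonce := hbase.1
      nm_ne_base := hne
      Z_deducible := hZded
      Z_early := fun j u hu s hs hsu =>
        horig.ded_subterm_sent hu hsu fun h => hs.2 (Or.inl h)
      sent_fresh := fun j u hu => hfresh u (hsentH j u hu) }
  have hArg : A.ArgClosed H := by
    intro g ts hts hZ i
    have hrig : .app g ts ∈ G ∪ rigid := by_contra fun h => hZ ⟨hts, h⟩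
    rcases hrig with ⟨r, hr, hv, he⟩ | ⟨q, hq, r, hr, hv, he⟩
    · cases r with
      | var x => exact absurd ⟨x, rfl⟩ hv
      | const c => cases he
      | app g' rs =>
        cases he
        exact Or.inl ⟨rs i, mem_Sub_of_mem_subterms hr (Term.arg_mem_subterms _ rs i), rfl⟩
    · cases r with
      | var x => exact absurd ⟨x, rfl⟩ hv
      | const c => cases he
      | app g' rs =>
        cases he
        exact Or.inr (hmem_aux.2
          ⟨q, hq, rs i, mem_Sub_of_mem_subterms hr (Term.arg_mem_subterms _ rs i), rfl⟩)
  have hded : ∀ i, ∀ s ∈ H, 𝒟.Ded Set.univ (A.K i) s →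
      𝒟.Ded Set.univ (A.abstract '' A.K i) (A.abstract s) := fun i s hs h =>
    A.ded_abstract horig hI
      (fun q hq r hr hv hZ => hZ.2 (Or.inr ⟨q, hq, r, hr, hv, rfl⟩))
      (fun q hq p hp => Or.inr (hmem_aux.2 ⟨q, hq, p, subset_Sub _ hp, rfl⟩)) hArg hs h
  classical
  let τ : Subst Sg := fun x => if x ∈ Vars S.terms then A.abstract (σ x) else .var x
  have hτx : ∀ x ∈ Vars S.terms, τ x = A.abstract (σ x) := fun x hx => if_pos hx
  have hτ : ∀ t ∈ Sub S.terms, t.subst τ = A.abstract (t.subst σ) := by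
    intro t ht
    rw [A.abstract_subst fun r hr hv hZ =>
      hZ.2 (Or.inl ⟨r, mem_Sub_of_mem_subterms ht hr, hv, rfl⟩)]
    exact Term.subst_congr fun x hx => hτx x (mem_Vars_of_mem_Sub ht hx)
  have hτground : ∀ x ∈ Vars S.terms, (τ x).IsGround := by
    intro x hx
    rw [hτx x hx]
    exact A.isGround_abstract (hσ.isGround_subst (var_mem_Sub hx))
  have hdom : τ.dom = Vars S.terms := by
    ext x
    by_cases hx : x ∈ Vars S.terms
    · refine iff_of_true (fun h => ?_) hx
      exact Term.isGround_iff.1 (hτground x hx) x (h ▸ Term.mem_subterms_self _)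
    · exact iff_of_false (fun h => h (if_neg hx)) hx
  have hknow : ∀ i, S.knowledge τ i = A.abstract '' A.K (i + 1) := by
    intro i
    rw [show A.K (i + 1) = S.knowledge σ i from (S.knowledge_eq i).symm]
    ext w
    constructor
    · rintro ⟨j, hj, t, ht, rfl⟩
      exact ⟨t.subst σ, ⟨j, hj, t, ht, rfl⟩, (hτ t (snd_mem_Sub ht)).symm⟩
    · rintro ⟨_, ⟨j, hj, t, ht, rfl⟩, rfl⟩
      exact ⟨j, hj, t, ht, (hτ t (snd_mem_Sub ht)).symm⟩
  have hKground : ∀ i, ∀ t ∈ A.K i, t.IsGround := fun i t ⟨j, _, ht⟩ => hσ.isGround_sent ht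
  refine ⟨τ, ⟨fun x hx => hτground x (hdom ▸ hx), hdom, fun i t ht => ?_, fun i t ht h => ?_⟩, ?_⟩
  · have htS := subset_Sub _ (mem_terms ht)
    rw [hknow, hτ t htS]
    refine (hded _ _ (Or.inl ⟨t, htS, rfl⟩) (hσ.ded_rcv hsub ht)).mem_Der ?_
    rintro _ ⟨u, hu, rfl⟩
    exact A.isGround_abstract (hKground _ u hu)
  · have htS := subset_Sub _ (mem_terms ht)
    rw [hknow, hτ t htS] at h
    refine hσ.forbid i t ht ?_
    rw [S.knowledge_eq]
    exact (A.ded_of_ded_abstract (hσ.isGround_subst htS) (hfresh _ (Or.inl ⟨t, htS, rfl⟩))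
      (.of_mem_Der hsub h)).mem_Der (hKground _)
  · have hsize : (⋃ x ∈ τ.dom, insert (Term.var x) (τ x).subterms) ⊆
        Sub S.terms ∪ A.support H := by
      rw [hdom]
      refine Set.iUnion₂_subset fun x hx => Set.insert_subset (Or.inl (var_mem_Sub hx)) ?_
      rw [hτx x hx]
      exact (Abstraction.subterms_abstract_subset hArg hsentH
        (Or.inl ⟨_, var_mem_Sub hx, rfl⟩) (hσ.isGround_subst (var_mem_Sub hx))).trans
        Set.subset_union_right
    calc τ.size ≤ (Sub S.terms).encard + (3 * H.encard + 1) :=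
          (Set.encard_le_encard hsize).trans ((Set.encard_union_le _ _).trans
            (add_le_add le_rfl (A.encard_support_le hsentH Set.sdiff_subset)))
      _ ≤ (Sub S.terms).encard + (3 * ((1 + M) * (Sub S.terms).encard) + 1) := by gcongr
      _ = (4 + 3 * M) * (Sub S.terms).encard + 1 := by ring

end Deducibility

theorem mainTheorem2 {Sg : Deducibility.Signature.{u, v, w}}
    (𝒟 : Deducibility.DeductionSystem Sg) (hsub : 𝒟.IsSubterm)
    (hfree : 𝒟.HasFreeBinaryComposition) :
    ∃ p : Polynomial ℕ,
      ∀ (S : Deducibility.ConstraintSystem Sg) (σ σ' : Deducibility.Subst Sg)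
        (T : Set (Deducibility.Term Sg)) (D : List (Deducibility.Deduction Sg)),
        S.IsSolution 𝒟 σ →
        T.Finite → Deducibility.Sub S.terms ⊆ T →
        σ'.IsGround → σ'.dom = Deducibility.Vars T → (∀ x ∈ σ.dom, σ' x = σ x) →
        𝒟.IsDerivation D → 𝒟.IsMaximal T σ' D → 𝒟.OneToOneLocalizes T σ' D →
        Deducibility.NoStandardRepetition D →
        ∃ τ : Deducibility.Subst Sg,
          S.IsSolution 𝒟 τ ∧ τ.size ≤ (p.eval (Deducibility.Sub T).ncard : ℕ) := by
  obtain ⟨M, hM⟩ := 𝒟.exists_encard_Sub_premises_le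
  refine ⟨Polynomial.C (4 + 3 * M) * Polynomial.X + 1, ?_⟩
  intro S σ σ' T D hσ hT hST _ _ _ _ _ _ _
  obtain ⟨τ, hτ, hsize⟩ := hσ.exists_small hsub hfree hM (hT.subset hST)
  refine ⟨τ, hτ, hsize.trans ?_⟩
  have hcard : (Deducibility.Sub S.terms).encard ≤ (Deducibility.Sub T).ncard := by
    rw [(Deducibility.Sub_finite hT).cast_ncard_eq]
    exact Set.encard_le_encard (hST.trans (Deducibility.subset_Sub T))
  simp only [Polynomial.eval_add, Polynomial.eval_mul, Polynomial.eval_C, Polynomial.eval_X,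
    Polynomial.eval_one]
  push_cast
  gcongr
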